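/- Let $(M,g)$ be a smooth $n$-dimensional pseudo-Riemannian manifold of Lorentzian signature $(n-1,1)$ with Levi-Civita connection $\nabla$, and let $V\subset M$ be a smooth (immersed) lightlike hypersurface, i.e. $\dim V=n-1$ and $g$ degenerates on every tangent hyperplane $T_xV$. Let $\gamma$ be an isotropic geodesic of $V$, i.e. a geodesic line of $(M,g)$, with arbitrary parameter, lying on $V$ and with nonzero isotropic velocity. Let $x$ be a point of $\gamma$, let $e_1$ be a smooth field, defined on $V$ near $x$, of nonzero isotropic vectors tangent to $V$ whose value at $x$ is the velocity of $\gamma$, and let $e_2,\dots,e_{n-1}$ complete $e_1(x)$ to a basis of $T_xV$. Put, for $a,b=2,\dots,n-1$, $$g_{ab}=g(e_a,e_b),\qquad \lambda_{ab}=g(e_a,\nabla_{e_b}e_1),\qquad \lambda^a_b=g^{ac}\lambda_{cb}.$$ The development of $\gamma$ onto the affine space $T_xM$ with origin $x$ lies on the straight line $l=\{\,y=x+s e_1 : s\in\mathbb R\,\}$, which is completed by its point at infinity $s=\infty$. The tangent subspace $T_y\widetilde V\subset T_xM$ at $y=x+se_1$ of the development $\widetilde V$ of $V$ is spanned by the infinitesimal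 displacements $dy=v+\sigma e_1+s\nabla_v e_1$ ($v\in T_xV$, $\sigma\in\mathbb R$), and at the point at infinity by the vectors $\sigma e_1+\nabla_v e_1$. A point $y$ of $l$ (possibly the point at infinity) is called singular if $\dim T_y\widetilde V<n-1$. Its multiplicity is the multiplicity of $s$ as a root of the Jacobian $\det(\delta^a_b+s\lambda^a_b)$; for the point at infinity it is the multiplicity of $r=0$ as a root of $\det(r\delta^a_b+\lambda^a_b)$. Then the shape operator $(\lambda^a_b)$ is symmetric with respect to $g_{ab}$ (that is, $g_{ac}\lambda^c_b$ is symmetric) and has $n-2$ real eigenvalues $\lambda_2,\dots,\lambda_{n-1}$, counted with multiplicity. The line $l$ carries exactly $n-2$ real singular points, each counted with its multiplicity: the singular points are precisely the points $$F_a=x-\frac1{\lambda_a}e_1,\qquad a=2,\dots,n-1,$$ where $F_a$ is the point at infinity of $l$ if $\lambda_a=0$. The multiplicity of every point $y$ of $l$ equals the number of indices $a$ with $F_a=y$, and it also equals $n-1-\dim T_y\widetilde V$. -/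

import Mathlib

open Module Bundle Polynomial
open scoped Manifold ContDiff Topology

noncomputable section

/-- A smooth pseudo-Riemannian metric of Lorentzian signature `(n - 1, 1)` on the tangent bundle of
a smooth manifold `M` modelled on the `n`-dimensional space `E`. -/
structure LorentzianMetric (E : Type*) [NormedAddCommGroup E] [NormedSpace ℝ E]
    (M : Type*) [TopologicalSpace M] [ChartedSpace E M] [IsManifold 𝓘(ℝ, E) ∞ M] where
  /-- The scalar product on each tangent space. -/
  inner (x : M) : TangentSpace 𝓘(ℝ, E) x →L[ℝ] TangentSpace 𝓘(ℝ, E) x →L[ℝ] ℝ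
  symm (x : M) (v w : TangentSpace 𝓘(ℝ, E) x) : inner x v w = inner x w v
  contMDiff : ContMDiff 𝓘(ℝ, E) (𝓘(ℝ, E).prod 𝓘(ℝ, E →L[ℝ] E →L[ℝ] ℝ)) ∞
    (fun x ↦ TotalSpace.mk' (E →L[ℝ] E →L[ℝ] ℝ) x (inner x))
  sigPos_add_one (x : M) : sigPos (LinearMap.BilinMap.toQuadraticMap
    (LinearMap.mk₂ ℝ (fun v w : TangentSpace 𝓘(ℝ, E) x ↦ inner x v w)
      (by simp) (by simp) (by simp) (by simp))) + 1 = finrank ℝ E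
  sigNeg_eq_one (x : M) : sigNeg (LinearMap.BilinMap.toQuadraticMap
    (LinearMap.mk₂ ℝ (fun v w : TangentSpace 𝓘(ℝ, E) x ↦ inner x v w)
      (by simp) (by simp) (by simp) (by simp))) = 1

section LeviCivita

variable {E : Type*} [NormedAddCommGroup E] [NormedSpace ℝ E]
  {M : Type*} [TopologicalSpace M] [ChartedSpace E M] [IsManifold 𝓘(ℝ, E) ∞ M]

/-- The metric in the chart centred at `x₀`: the bilinear form `g_{ij}(y)` at the point with
coordinates `y`. -/
def LorentzianMetric.inChart (g : LorentzianMetric E M) (x₀ : M) (y : E) : E →L[ℝ] E →L[ℝ] ℝ :=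
  let φ := extChartAt 𝓘(ℝ, E) x₀
  let L : E →L[ℝ] TangentSpace 𝓘(ℝ, E) (φ.symm y) := mfderiv 𝓘(ℝ, E) 𝓘(ℝ, E) φ.symm y
  (ContinuousLinearMap.precomp ℝ L).comp ((g.inner (φ.symm y)).comp L)

set_option synthInstance.maxHeartbeats 200000 in
/-- The Christoffel symbols of the Levi-Civita connection in the chart centred at `x₀`:
`Γ(u, v)` is the vector such that, for all `z`,
`2 g(Γ(u, v), z) = (∂_u g)(v, z) + (∂_v g)(u, z) - (∂_z g)(u, v)`. -/
def LorentzianMetric.christoffel (g : LorentzianMetric E M) (x₀ : M) (y u v : E) : E :=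
  let D : E →L[ℝ] E →L[ℝ] E →L[ℝ] ℝ := fderiv ℝ (g.inChart x₀) y
  let θ : E →L[ℝ] ℝ := D u v + D v u - (D.flip u).flip v
  (g.inChart x₀ y).inverse ((1 / 2 : ℝ) • θ)

variable {F : Type*} [NormedAddCommGroup F] [NormedSpace ℝ F]
  {N : Type*} [TopologicalSpace N] [ChartedSpace F N]

/-- The Levi-Civita covariant derivative `∇_v X` at `p`, in the direction `v ∈ T_p N`, of a vector
field `X` along a map `f : N → M`. In the chart centred at `f p` it is given by
`∂_v X + Γ(df(v), X)`. -/
def LorentzianMetric.covDeriv (g : LorentzianMetric E M) (f : N → M)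
    (X : (q : N) → TangentSpace 𝓘(ℝ, E) (f q)) (p : N) (v : TangentSpace 𝓘(ℝ, F) p) :
    TangentSpace 𝓘(ℝ, E) (f p) :=
  let φ := extChartAt 𝓘(ℝ, E) (f p)
  let Xc : N → E := fun q ↦ mfderiv 𝓘(ℝ, E) 𝓘(ℝ, E) φ (f q) (X q)
  let vc : E := mfderiv 𝓘(ℝ, E) 𝓘(ℝ, E) φ (f p) (mfderiv 𝓘(ℝ, F) 𝓘(ℝ, E) f p v)
  let dXc : E := mfderiv 𝓘(ℝ, F) 𝓘(ℝ, E) Xc p v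
  let w : E := dXc + g.christoffel (f p) (φ (f p)) vc (Xc p)
  (mfderiv 𝓘(ℝ, E) 𝓘(ℝ, E) φ (f p)).inverse w

/-- A lightlike hypersurface of `(M, g)`: a smooth immersed submanifold of codimension one all of
whose tangent hyperplanes are isotropic, that is, `g` degenerates on each of them. -/
structure IsLightlikeHypersurface (g : LorentzianMetric E M) (ι : N → M) : Prop where
  codim_one : finrank ℝ F + 1 = finrank ℝ E
  contMDiff : ContMDiff 𝓘(ℝ, F) 𝓘(ℝ, E) ∞ ι
  injective (p : N) : Function.Injective (mfderiv 𝓘(ℝ, F) 𝓘(ℝ, E) ι p)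
  degenerate (p : N) : ∃ ζ : TangentSpace 𝓘(ℝ, F) p, ζ ≠ 0 ∧ ∀ w : TangentSpace 𝓘(ℝ, F) p,
    g.inner (ι p) (mfderiv 𝓘(ℝ, F) 𝓘(ℝ, E) ι p ζ) (mfderiv 𝓘(ℝ, F) 𝓘(ℝ, E) ι p w) = 0

/-- The velocity of a curve `γ` in a manifold. -/
def velocity (γ : ℝ → M) (t : ℝ) : TangentSpace 𝓘(ℝ, E) (γ t) :=
  mfderiv 𝓘(ℝ, ℝ) 𝓘(ℝ, E) γ t (1 : ℝ)

/-- The curve `c` on the hypersurface `ι : N → M`, defined on the open interval `J`, is an isotropic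
geodesic: its velocity is isotropic and nonzero, and `γ = ι ∘ c` is a geodesic line of `(M, g)`,
`∇_{γ'} γ' = α γ'` (the parameter is arbitrary). -/
structure IsIsotropicGeodesic (g : LorentzianMetric E M) (ι : N → M) (c : ℝ → N) (J : Set ℝ) :
    Prop where
  isOpen : IsOpen J
  ordConnected : J.OrdConnected
  contMDiffOn : ContMDiffOn 𝓘(ℝ, ℝ) 𝓘(ℝ, F) ∞ c J
  velocity_ne_zero (t : ℝ) (ht : t ∈ J) : velocity (E := F) c t ≠ 0
  isotropic (t : ℝ) (ht : t ∈ J) :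
    g.inner ((ι ∘ c) t) (velocity (ι ∘ c) t) (velocity (ι ∘ c) t) = 0
  geodesic : ∃ α : ℝ → ℝ, ∀ t ∈ J,
    g.covDeriv (F := ℝ) (ι ∘ c) (velocity (ι ∘ c)) t (1 : ℝ) = α t • velocity (ι ∘ c) t

/-- `ξ` is, near `p`, a smooth field of nonzero isotropic vectors tangent to the hypersurface. The
vector field `e₁` along the hypersurface is its image under the differential of `ι`. -/
structure IsIsotropicFieldAt (g : LorentzianMetric E M) (ι : N → M)
    (ξ : (q : N) → TangentSpace 𝓘(ℝ, F) q) [IsManifold 𝓘(ℝ, F) ∞ N] (p : N) : Prop where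
  contMDiffAt : ContMDiffAt 𝓘(ℝ, F) 𝓘(ℝ, F).tangent ∞
    (fun q ↦ (⟨q, ξ q⟩ : TangentBundle 𝓘(ℝ, F) N)) p
  ne_zero : ∀ᶠ q in 𝓝 p, ξ q ≠ 0
  isotropic : ∀ᶠ q in 𝓝 p, g.inner (ι q) (mfderiv 𝓘(ℝ, F) 𝓘(ℝ, E) ι q (ξ q))
    (mfderiv 𝓘(ℝ, F) 𝓘(ℝ, E) ι q (ξ q)) = 0

/-- The vector field `e₁` along the hypersurface `ι`, as a field of vectors tangent to `M`. -/
def isotropicVector (ι : N → M) (ξ : (q : N) → TangentSpace 𝓘(ℝ, F) q) (q : N) :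
    TangentSpace 𝓘(ℝ, E) (ι q) :=
  mfderiv 𝓘(ℝ, F) 𝓘(ℝ, E) ι q (ξ q)

/-- The covariant differential `de₁` of the field `e₁` at `p` in the direction `v`. -/
def dIsotropicVector (g : LorentzianMetric E M) (ι : N → M)
    (ξ : (q : N) → TangentSpace 𝓘(ℝ, F) q) (p : N) (v : TangentSpace 𝓘(ℝ, F) p) :
    TangentSpace 𝓘(ℝ, E) (ι p) :=
  g.covDeriv ι (isotropicVector (E := E) ι ξ) p v

/-- The matrix `g_{ab} = g(e_a, e_b)` of the first fundamental form in the screen frame `e`. -/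
def screenMetric (g : LorentzianMetric E M) (ι : N → M) (p : N) {k : ℕ}
    (e : Fin k → TangentSpace 𝓘(ℝ, F) p) : Matrix (Fin k) (Fin k) ℝ :=
  Matrix.of fun a b ↦ g.inner (ι p) (mfderiv 𝓘(ℝ, F) 𝓘(ℝ, E) ι p (e a))
    (mfderiv 𝓘(ℝ, F) 𝓘(ℝ, E) ι p (e b))

/-- The second fundamental tensor `λ_{ab} = g(e_a, ∇_{e_b} e₁)` in the screen frame `e`. -/
def secondFundamentalTensor (g : LorentzianMetric E M) (ι : N → M)
    (ξ : (q : N) → TangentSpace 𝓘(ℝ, F) q) (p : N) {k : ℕ}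
    (e : Fin k → TangentSpace 𝓘(ℝ, F) p) : Matrix (Fin k) (Fin k) ℝ :=
  Matrix.of fun a b ↦ g.inner (ι p) (mfderiv 𝓘(ℝ, F) 𝓘(ℝ, E) ι p (e a))
    (dIsotropicVector g ι ξ p (e b))

/-- The shape operator `λ^a_b = g^{ac} λ_{cb}` in the screen frame `e`. -/
def shapeOperator (g : LorentzianMetric E M) (ι : N → M)
    (ξ : (q : N) → TangentSpace 𝓘(ℝ, F) q) (p : N) {k : ℕ}
    (e : Fin k → TangentSpace 𝓘(ℝ, F) p) : Matrix (Fin k) (Fin k) ℝ :=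
  (screenMetric g ι p e)⁻¹ * secondFundamentalTensor g ι ξ p e

/-- Let `x = ι p`, and let `l` be the straight line `{x + s e₁}` of the affine space `T_x M`,
completed by its point at infinity; its points are given by `s : OnePoint ℝ`. The infinitesimal
displacement of the moving point `y = x + s e₁`, when `x` moves on the hypersurface with velocity `v`
and `s` changes with rate `σ`, is `dy = dx + s de₁ + σ e₁`; for the point at infinity (the direction
of `e₁`), `dx` is absent: `dy = de₁ + σ e₁`. Here `d` is the covariant differential, which is the
derivative at `x` of the moving point developed onto `T_x M` by parallel displacement. The tangent subspace at `y` of the development of the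
hypersurface onto `T_x M` is the subspace spanned by these displacements. -/
def developedTangentSpace (g : LorentzianMetric E M) (ι : N → M)
    (ξ : (q : N) → TangentSpace 𝓘(ℝ, F) q) (p : N) :
    OnePoint ℝ → Submodule ℝ (TangentSpace 𝓘(ℝ, E) (ι p))
  | OnePoint.some s => Submodule.span ℝ {w | ∃ (v : TangentSpace 𝓘(ℝ, F) p) (σ : ℝ),
      w = mfderiv 𝓘(ℝ, F) 𝓘(ℝ, E) ι p v + s • dIsotropicVector g ι ξ p v
        + σ • isotropicVector ι ξ p}
  | OnePoint.infty => Submodule.span ℝ {w | ∃ (v : TangentSpace 𝓘(ℝ, F) p) (σ : ℝ),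
      w = dIsotropicVector g ι ξ p v + σ • isotropicVector ι ξ p}

/-- The point `y` of the completed line `l` is singular: the tangent subspace of the developed
hypersurface at `y` has dimension less than the dimension `n - 1` of the hypersurface. -/
def IsSingularPoint (g : LorentzianMetric E M) (ι : N → M)
    (ξ : (q : N) → TangentSpace 𝓘(ℝ, F) q) (p : N) (y : OnePoint ℝ) : Prop :=
  finrank ℝ (developedTangentSpace g ι ξ p y) < finrank ℝ F

end LeviCivita

/-- The Jacobian `det (δ^a_b + s λ^a_b)`, as a polynomial in the coordinate `s` on `l`. -/
def jacobian {k : ℕ} (L : Matrix (Fin k) (Fin k) ℝ) : ℝ[X] :=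
  (1 + (X : ℝ[X]) • L.map C).det

/-- The Jacobian in the coordinate `r = 1 / s` around the point at infinity:
`det (r δ^a_b + λ^a_b)`. -/
def jacobianAtInfinity {k : ℕ} (L : Matrix (Fin k) (Fin k) ℝ) : ℝ[X] :=
  ((X : ℝ[X]) • (1 : Matrix (Fin k) (Fin k) ℝ[X]) + L.map C).det

/-- The multiplicity of a point of the completed line `l`: its multiplicity as a root of the
Jacobian. -/
def singularMultiplicity {k : ℕ} (L : Matrix (Fin k) (Fin k) ℝ) : OnePoint ℝ → ℕ
  | OnePoint.some s => (jacobian L).rootMultiplicity s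
  | OnePoint.infty => (jacobianAtInfinity L).rootMultiplicity 0

/-- The coordinate on `l` of the point `x - (1 / μ) e₁`, which is the point at infinity
when `μ = 0`. -/
def focus (μ : ℝ) : OnePoint ℝ := if μ = 0 then OnePoint.infty else ((-(1 / μ) : ℝ) : OnePoint ℝ)

end

/-! Write $T=T_xV$. In Lorentzian signature two independent orthogonal vectors cannot both have
nonpositive square (`not_linearIndependent_pair_of_nonpos`). Hence the isotropic vectors of a
degenerate hyperplane form a single line, $e_1$ spans the radical of $T$, $T=e_1^\perp$, and $g$ is
positive definite on the screen $T/e_1$.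

Differentiating $g(a,e_1)=0$ along $V$ shows that $g(a,\nabla_b e_1)$ is symmetric in $a,b$, because
the connection is metric and torsion-free; differentiating $g(e_1,e_1)=0$ shows $\nabla_b e_1\in
e_1^\perp=T$ (`local_second_form_symm`, `local_second_form_null`). By symmetry $\nabla_{e_1}e_1$ is
then orthogonal to $T$, so $v\mapsto\nabla_v e_1$ descends to $T/e_1$, where its matrix is
$A=(\lambda^a_b)$. Being symmetric for a positive definite form, $A$ is diagonalizable over the
reals.

The displacements at $s$ always contain $e_1$, and modulo $e_1$ they form the range of $1+sA$ (of
$A$ at infinity); so the dimension is one more than that rank (`finrank_displacements`). In an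
eigenbasis the Jacobian is $\prod(1+s\lambda_a)$. Its factors have degree at most one, so both the
multiplicity of a root and the rank defect count the vanishing factors, that is, the indices $a$
with $F_a=y$. -/

noncomputable section

/-! ### The second fundamental form of a lightlike hypersurface in local coordinates -/

section LocalSecondFundamentalForm

set_option synthInstance.maxHeartbeats 200000

variable {E F : Type*} [NormedAddCommGroup E] [NormedSpace ℝ E]
  [NormedAddCommGroup F] [NormedSpace ℝ F]
  {G : E → E →L[ℝ] E →L[ℝ] ℝ} {f : F → E} {ξ : F → F} {z : F} {Γ : E → E → E}

/-- The derivative of the identity `G (df a) (df ξ) = 0`. -/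
theorem deriv_null_identity (hf : ContDiffAt ℝ 2 f z) (hG : DifferentiableAt ℝ G (f z))
    (hξ : DifferentiableAt ℝ ξ z)
    (hnull : ∀ᶠ q in 𝓝 z, ∀ a, G (f q) (fderiv ℝ f q a) (fderiv ℝ f q (ξ q)) = 0) (a b : F) :
    fderiv ℝ G (f z) (fderiv ℝ f z b) (fderiv ℝ f z a) (fderiv ℝ f z (ξ z))
      + G (f z) (fderiv ℝ (fderiv ℝ f) z b a) (fderiv ℝ f z (ξ z))
      + G (f z) (fderiv ℝ f z a) (fderiv ℝ (fun q ↦ fderiv ℝ f q (ξ q)) z b) = 0 := by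
  have hfd : DifferentiableAt ℝ f z := hf.differentiableAt (by norm_num)
  have hDf : DifferentiableAt ℝ (fderiv ℝ f) z :=
    (hf.fderiv_right (m := 1) (by norm_num)).differentiableAt (by norm_num)
  have hX : DifferentiableAt ℝ (fun q ↦ fderiv ℝ f q (ξ q)) z := hDf.clm_apply hξ
  have hGf := HasFDerivAt.comp (G := E →L[ℝ] E →L[ℝ] ℝ) z hG.hasFDerivAt hfd.hasFDerivAt
  have ha : HasFDerivAt (fun q ↦ fderiv ℝ f q a) _ z :=
    hDf.hasFDerivAt.clm_apply (hasFDerivAt_const a z)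
  have h1 := (hGf.clm_apply ha).clm_apply hX.hasFDerivAt
  have h0 : (fun q ↦ G (f q) (fderiv ℝ f q a) (fderiv ℝ f q (ξ q))) =ᶠ[𝓝 z] fun _ ↦ (0 : ℝ) :=
    hnull.mono fun q hq ↦ hq a
  have h2 := h1.unique ((hasFDerivAt_const (0 : ℝ) z).congr_of_eventuallyEq h0)
  have h3 := DFunLike.congr_fun h2 b
  simp at h3
  linarith

/-- The form `(a, b) ↦ G (df a) (∇_b (df ξ))` is symmetric. -/
theorem local_second_form_symm (hf : ContDiffAt ℝ 2 f z) (hG : DifferentiableAt ℝ G (f z))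
    (hξ : DifferentiableAt ℝ ξ z) (hs : ∀ y u v, G y u v = G y v u)
    (hnull : ∀ᶠ q in 𝓝 z, ∀ a, G (f q) (fderiv ℝ f q a) (fderiv ℝ f q (ξ q)) = 0)
    (hΓ : ∀ u v w, 2 * G (f z) (Γ u v) w = fderiv ℝ G (f z) u v w + fderiv ℝ G (f z) v u w
      - fderiv ℝ G (f z) w u v) (a b : F) :
    G (f z) (fderiv ℝ f z a) (fderiv ℝ (fun q ↦ fderiv ℝ f q (ξ q)) z b
        + Γ (fderiv ℝ f z b) (fderiv ℝ f z (ξ z)))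
      = G (f z) (fderiv ℝ f z b) (fderiv ℝ (fun q ↦ fderiv ℝ f q (ξ q)) z a
        + Γ (fderiv ℝ f z a) (fderiv ℝ f z (ξ z))) := by
  -- Differentiating the symmetry of `G` makes each of its directional derivatives symmetric.
  have hD : ∀ u v w, fderiv ℝ G (f z) u v w = fderiv ℝ G (f z) u w v := by
    intro u v w
    have h1 := (hG.hasFDerivAt.clm_apply (hasFDerivAt_const v (f z))).clm_apply
      (hasFDerivAt_const w (f z))
    have h2 := (hG.hasFDerivAt.clm_apply (hasFDerivAt_const w (f z))).clm_apply
      (hasFDerivAt_const v (f z))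
    simp only [hs _ v w] at h1
    have := DFunLike.congr_fun (h1.unique h2) u
    simpa using this
  -- Equality of mixed partials; with the symmetric Christoffel formula it plays the role of zero
  -- torsion.
  have hsym : fderiv ℝ (fderiv ℝ f) z b a = fderiv ℝ (fderiv ℝ f) z a b :=
    (hf.isSymmSndFDerivAt (by simp)).eq b a
  have h1 := deriv_null_identity hf hG hξ hnull a b
  have h2 := deriv_null_identity hf hG hξ hnull b a
  rw [hsym] at h1
  set X := fderiv ℝ f z (ξ z)
  set A := fderiv ℝ f z a
  set B := fderiv ℝ f z b
  have h3 := hΓ B X A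
  have h4 := hΓ A X B
  -- Once `h1` and `h3` are inserted, the left side is
  -- $\frac12(\partial_XG(A,B)-\partial_BG(A,X)-\partial_AG(B,X))-G(\partial_a\partial_bf,X)$,
  -- visibly symmetric in $A,B$.
  rw [map_add, map_add, hs _ A (Γ _ _), hs _ B (Γ _ _)]
  linarith [hD B X A, hD A X B, hD X A B, hD X B A, hD A B X, hD B A X]

/-- The vector `∇_b (df ξ)` is orthogonal to `df ξ`. -/
theorem local_second_form_null (hf : ContDiffAt ℝ 2 f z) (hG : DifferentiableAt ℝ G (f z))
    (hξ : DifferentiableAt ℝ ξ z) (hs : ∀ y u v, G y u v = G y v u)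
    (hnull : ∀ᶠ q in 𝓝 z, ∀ a, G (f q) (fderiv ℝ f q a) (fderiv ℝ f q (ξ q)) = 0)
    (hΓ : ∀ u v w, 2 * G (f z) (Γ u v) w = fderiv ℝ G (f z) u v w + fderiv ℝ G (f z) v u w
      - fderiv ℝ G (f z) w u v) (b : F) :
    G (f z) (fderiv ℝ f z (ξ z)) (fderiv ℝ (fun q ↦ fderiv ℝ f q (ξ q)) z b
        + Γ (fderiv ℝ f z b) (fderiv ℝ f z (ξ z))) = 0 := by
  have hfd : DifferentiableAt ℝ f z := hf.differentiableAt (by norm_num)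
  have hDf : DifferentiableAt ℝ (fderiv ℝ f) z :=
    (hf.fderiv_right (m := 1) (by norm_num)).differentiableAt (by norm_num)
  have hX : DifferentiableAt ℝ (fun q ↦ fderiv ℝ f q (ξ q)) z := hDf.clm_apply hξ
  have hGf := HasFDerivAt.comp (G := E →L[ℝ] E →L[ℝ] ℝ) z hG.hasFDerivAt hfd.hasFDerivAt
  have h1 := (hGf.clm_apply hX.hasFDerivAt).clm_apply hX.hasFDerivAt
  have h0 : (fun q ↦ G (f q) (fderiv ℝ f q (ξ q)) (fderiv ℝ f q (ξ q))) =ᶠ[𝓝 z]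
      fun _ ↦ (0 : ℝ) := hnull.mono fun q hq ↦ hq (ξ q)
  have h2 := h1.unique ((hasFDerivAt_const (0 : ℝ) z).congr_of_eventuallyEq h0)
  have h3 := DFunLike.congr_fun h2 b
  simp at h3
  -- With $X$ in both slots the last two terms cancel, leaving $2G(\Gamma(B,X),X)=\partial_BG(X,X)$,
  -- which compensates the derivative of $G$ in `h3`.
  have h4 := hΓ (fderiv ℝ f z b) (fderiv ℝ f z (ξ z)) (fderiv ℝ f z (ξ z))
  have hD : fderiv ℝ G (f z) (fderiv ℝ f z (ξ z)) (fderiv ℝ f z b) (fderiv ℝ f z (ξ z))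
      = fderiv ℝ G (f z) (fderiv ℝ f z (ξ z)) (fderiv ℝ f z (ξ z)) (fderiv ℝ f z b) := by
    have h1 := (hG.hasFDerivAt.clm_apply (hasFDerivAt_const (fderiv ℝ f z b) (f z))).clm_apply
      (hasFDerivAt_const (fderiv ℝ f z (ξ z)) (f z))
    have h2 := (hG.hasFDerivAt.clm_apply (hasFDerivAt_const (fderiv ℝ f z (ξ z)) (f z))).clm_apply
      (hasFDerivAt_const (fderiv ℝ f z b) (f z))
    simp only [hs _ (fderiv ℝ f z b) (fderiv ℝ f z (ξ z))] at h1
    simpa using DFunLike.congr_fun (h1.unique h2) (fderiv ℝ f z (ξ z))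
  rw [map_add, hs _ _ (Γ _ _)]
  rw [hs _ (fderiv ℝ (fun q ↦ fderiv ℝ f q (ξ q)) z b)] at h3
  linarith

end LocalSecondFundamentalForm

/-! ### Operators that are symmetric with respect to a positive definite form -/

section SymmetricOperator

variable {k : ℕ}

open scoped MatrixOrder in
/-- An operator that is symmetric with respect to a positive definite form is diagonalizable. -/
theorem Matrix.PosDef.exists_diagonalization_inv_mul {G S : Matrix (Fin k) (Fin k) ℝ}
    (hG : G.PosDef) (hS : S.IsSymm) :
    ∃ (P : (Matrix (Fin k) (Fin k) ℝ)ˣ) (d : Fin k → ℝ),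
      G⁻¹ * S = P.1 * Matrix.diagonal d * P⁻¹.1 := by
  -- With $G=u^*u$, the matrix $G^{-1}S=u^{-1}(u^{-*}Su^{-1})u$ is similar to a Hermitian one, to
  -- which the spectral theorem applies.
  obtain ⟨b, ⟨u, rfl⟩, hb⟩ := CStarAlgebra.isStrictlyPositive_iff_eq_star_mul_self.1
    hG.isStrictlyPositive
  have hH : (star u⁻¹.1 * S * u⁻¹.1).IsHermitian := by
    rw [Matrix.IsHermitian, ← Matrix.star_eq_conjTranspose]
    have : star S = S := by
      rw [Matrix.star_eq_conjTranspose, Matrix.conjTranspose_eq_transpose_of_trivial]; exact hS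
    simp [mul_assoc, this]
  obtain ⟨U, d, hU⟩ : ∃ (U : Matrix.unitaryGroup (Fin k) ℝ) (d : Fin k → ℝ),
      star u⁻¹.1 * S * u⁻¹.1 = U.1 * Matrix.diagonal d * star U.1 :=
    ⟨hH.eigenvectorUnitary, hH.eigenvalues, hH.spectral_theorem⟩
  have hG' : G⁻¹ = u⁻¹.1 * star u⁻¹.1 := by
    apply Matrix.inv_eq_left_inv
    rw [hb, mul_assoc, ← mul_assoc (star u⁻¹.1), ← star_mul]
    simp
  have hS' : star u⁻¹.1 * S = (star u⁻¹.1 * S * u⁻¹.1) * u.1 := by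
    simp [mul_assoc]
  refine ⟨u⁻¹ * Unitary.toUnits U, d, ?_⟩
  rw [hG', mul_assoc, hS', hU]
  simp only [Units.val_mul, mul_assoc]
  rfl

variable {L : Matrix (Fin k) (Fin k) ℝ} {P : (Matrix (Fin k) (Fin k) ℝ)ˣ} {d : Fin k → ℝ}

theorem charpoly_of_diagonalization (h : L = P.1 * Matrix.diagonal d * P⁻¹.1) :
    L.charpoly = ∏ a, (X - C (d a)) := by
  rw [h, Matrix.coe_units_inv, Matrix.charpoly_units_conj, Matrix.charpoly_diagonal]

/-- The two polynomial coefficients cover both charts of the completed line: $(1,X)$ gives the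
Jacobian in $s$, $(X,1)$ the one in $r=1/s$. -/
theorem det_pencil_of_diagonalization (h : L = P.1 * Matrix.diagonal d * P⁻¹.1) (p q : ℝ[X]) :
    (p • (1 : Matrix (Fin k) (Fin k) ℝ[X]) + q • L.map C).det = ∏ a, (p + q * C (d a)) := by
  have hP : P.1.map C * (P⁻¹.1).map C = (1 : Matrix (Fin k) (Fin k) ℝ[X]) := by
    rw [← Matrix.map_mul, Units.mul_inv, Matrix.map_one _ (map_zero _) (map_one _)]
  have hD : (Matrix.diagonal fun a ↦ p + q * C (d a))
      = p • (1 : Matrix (Fin k) (Fin k) ℝ[X]) + q • Matrix.diagonal fun a ↦ C (d a) := by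
    rw [← Matrix.diagonal_one, ← Matrix.diagonal_smul, ← Matrix.diagonal_smul,
      Matrix.diagonal_add]
    congr 1; funext a; simp
  have : p • (1 : Matrix (Fin k) (Fin k) ℝ[X]) + q • L.map C
      = P.1.map C * (Matrix.diagonal fun a ↦ p + q * C (d a)) * (P⁻¹.1).map C := by
    rw [hD, mul_add, add_mul, Matrix.mul_smul, Matrix.smul_mul, mul_one, hP, Matrix.mul_smul,
      Matrix.smul_mul, h, Matrix.map_mul, Matrix.map_mul, Matrix.diagonal_map (map_zero _)]
  rw [this, Matrix.det_mul, Matrix.det_mul, mul_right_comm, ← Matrix.det_mul, hP, Matrix.det_one,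
    one_mul, Matrix.det_diagonal]

/-- Conjugation keeps the rank, and a diagonal matrix loses one for each zero entry; these entries
are the factors of the determinant in `det_pencil_of_diagonalization`. -/
theorem rank_pencil_of_diagonalization (h : L = P.1 * Matrix.diagonal d * P⁻¹.1) (α β : ℝ) :
    (α • (1 : Matrix (Fin k) (Fin k) ℝ) + β • L).rank + {a | α + β * d a = 0}.ncard = k := by
  classical
  have : α • (1 : Matrix (Fin k) (Fin k) ℝ) + β • L
      = P.1 * (Matrix.diagonal fun a ↦ α + β * d a) * P⁻¹.1 := by
    have hD : (Matrix.diagonal fun a ↦ α + β * d a)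
        = α • (1 : Matrix (Fin k) (Fin k) ℝ) + β • Matrix.diagonal d := by
      rw [← Matrix.diagonal_one, ← Matrix.diagonal_smul, ← Matrix.diagonal_smul,
        Matrix.diagonal_add]
      congr 1; funext a; simp
    rw [hD, mul_add, add_mul, Matrix.mul_smul, Matrix.smul_mul, mul_one, Units.mul_inv,
      Matrix.mul_smul, Matrix.smul_mul, h]
  rw [this, Matrix.rank_mul_eq_left_of_isUnit_det _ _ ((Matrix.isUnit_iff_isUnit_det _).1
    (Units.isUnit _)), Matrix.rank_mul_eq_right_of_isUnit_det _ _
    ((Matrix.isUnit_iff_isUnit_det _).1 (Units.isUnit _)), Matrix.rank_diagonal,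
    Fintype.card_subtype, Set.ncard_eq_toFinset_card', Set.toFinset_ofPred, add_comm,
    Finset.card_filter_add_card_filter_not]
  simp

/-- The form without division also covers $\mu=0$, where both sides are false. -/
theorem focus_eq_coe_iff (μ s : ℝ) : focus μ = (s : OnePoint ℝ) ↔ 1 + s * μ = 0 := by
  unfold focus
  split_ifs with h
  · simp [h]
  · rw [OnePoint.coe_eq_coe]
    constructor
    · rintro rfl; field_simp; ring
    · intro h'; field_simp; linarith

theorem focus_eq_infty_iff (μ : ℝ) : focus μ = OnePoint.infty ↔ μ = 0 := by
  unfold focus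
  split_ifs with h <;> simp [h]

/-- Multiplicities add over a product, and here each factor contributes 0 or 1. -/
theorem rootMultiplicity_prod_eq_ncard (p : Fin k → ℝ[X]) (hp : ∀ a, p a ≠ 0) (r : ℝ)
    (hr : ∀ a, (p a).rootMultiplicity r ≤ 1) :
    (∏ a, p a).rootMultiplicity r = {a | (p a).IsRoot r}.ncard := by
  classical
  rw [← count_roots, roots_prod _ _ (Finset.prod_ne_zero_iff.2 fun a _ ↦ hp a),
    Multiset.count_bind, Set.ncard_eq_toFinset_card', Set.toFinset_ofPred, Finset.card_filter]
  refine Finset.sum_congr rfl fun a _ ↦ ?_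
  rw [count_roots]
  have := rootMultiplicity_pos (x := r) (hp a)
  have := hr a
  split_ifs with h <;> grind

theorem rootMultiplicity_le_one_of_natDegree_le {p : ℝ[X]} (h : p.natDegree ≤ 1) (r : ℝ) :
    p.rootMultiplicity r ≤ 1 := by
  rw [← count_roots]
  exact (Multiset.count_le_card _ _).trans ((card_roots' p).trans h)

theorem singularMultiplicity_of_diagonalization (h : L = P.1 * Matrix.diagonal d * P⁻¹.1)
    (y : OnePoint ℝ) : singularMultiplicity L y = {a | focus (d a) = y}.ncard := by
  cases y with
  | infty =>
    have h1 : jacobianAtInfinity L = ∏ a, (X + C (d a)) := by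
      have := det_pencil_of_diagonalization h X 1
      simpa [jacobianAtInfinity] using this
    change (jacobianAtInfinity L).rootMultiplicity 0 = _
    rw [h1, rootMultiplicity_prod_eq_ncard _ (fun a ↦ X_add_C_ne_zero _) _
      (fun a ↦ rootMultiplicity_le_one_of_natDegree_le (by simp) _)]
    congr 1; ext a; simp [focus_eq_infty_iff]
  | coe s =>
    have h1 : jacobian L = ∏ a, (1 + X * C (d a)) := by
      have := det_pencil_of_diagonalization h 1 X
      simpa [jacobian] using this
    change (jacobian L).rootMultiplicity s = _
    rw [h1, rootMultiplicity_prod_eq_ncard _ _ _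
      (fun a ↦ rootMultiplicity_le_one_of_natDegree_le (by compute_degree) _)]
    · congr 1; ext a; simp [focus_eq_coe_iff, mul_comm s]
    · intro a h0
      -- The factor takes the value 1 at 0, so it is a nonzero polynomial even when `d a = 0`.
      simpa using congrArg (eval 0) h0

end SymmetricOperator

/-! ### Lightlike hyperplanes of a Lorentzian vector space -/

section DisplacementSets

variable {W : Type*} [AddCommGroup W] [Module ℝ W]

/-- With `setOf_zero_smul_add`, this lets finite points, with coefficients $(1,s)$, and the point at
infinity, with $(0,1)$, share one dimension formula. -/
theorem setOf_one_smul_add {V : Type*} (f h : V → W) (x : W) (s : ℝ) :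
    {w | ∃ (v : V) (σ : ℝ), w = (1 : ℝ) • f v + s • h v + σ • x}
      = {w | ∃ (v : V) (σ : ℝ), w = f v + s • h v + σ • x} := by
  simp only [one_smul]

theorem setOf_zero_smul_add {V : Type*} (f h : V → W) (x : W) :
    {w | ∃ (v : V) (σ : ℝ), w = (0 : ℝ) • f v + (1 : ℝ) • h v + σ • x}
      = {w | ∃ (v : V) (σ : ℝ), w = h v + σ • x} := by
  simp only [zero_smul, zero_add, one_smul]

end DisplacementSets

section LorentzianSpace

variable {W : Type*} [AddCommGroup W] [Module ℝ W] [FiniteDimensional ℝ W]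
  {β : LinearMap.BilinMap ℝ W ℝ}

/-- A Lorentzian space has no two-dimensional subspace on which the form is nonpositive. -/
theorem not_linearIndependent_pair_of_nonpos (hpos : sigPos β.toQuadraticMap + 1 = finrank ℝ W)
    {u w : W} (hu : β u u ≤ 0) (hw : β w w ≤ 0) (huw : β u w = 0) (hwu : β w u = 0) :
    ¬ LinearIndependent ℝ ![u, w] := by
  intro hli
  have h2 := finrank_span_eq_card hli
  have hle : ∀ y ∈ Submodule.span ℝ (Set.range ![u, w]), β.toQuadraticMap y ≤ 0 := by
    intro y hy
    rw [Matrix.range_cons, Matrix.range_cons, Matrix.range_empty, Set.union_empty,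
      Set.singleton_union] at hy
    obtain ⟨a, b, rfl⟩ := Submodule.mem_span_pair.1 hy
    simp only [LinearMap.BilinMap.toQuadraticMap_apply, map_add, map_smul, LinearMap.add_apply,
      LinearMap.smul_apply, huw, hwu, smul_eq_mul]
    nlinarith [mul_nonneg (mul_self_nonneg a) (neg_nonneg.2 hu),
      mul_nonneg (mul_self_nonneg b) (neg_nonneg.2 hw)]
  -- A nonpositive plane leaves room for at most $n-2$ positive directions, against the $n-1$ of the
  -- signature.
  have := QuadraticForm.sigPos_add_finrank_le_of_nonpos hle
  rw [h2, Fintype.card_fin] at this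
  omega

/-- A Lorentzian form is nondegenerate. -/
theorem eq_zero_of_lorentzian_of_forall_eq_zero
    (hpos : sigPos β.toQuadraticMap + 1 = finrank ℝ W) (hneg : sigNeg β.toQuadraticMap = 1)
    (hs : ∀ u w, β u w = β w u) {u : W} (hu : ∀ w, β u w = 0) : u = 0 := by
  have h := QuadraticForm.sigPos_add_sigNeg_add_radical (Q := β.toQuadraticMap)
  -- The positive and negative indices already add up to the full dimension.
  have h0 : finrank ℝ (QuadraticMap.radical β.toQuadraticMap) = 0 := by omega
  have hm : u ∈ QuadraticMap.radical β.toQuadraticMap := by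
    rw [QuadraticMap.mem_radical_iff']
    refine ⟨hu u, fun w ↦ ?_⟩
    simp [hu, hs w u]
  rw [Submodule.finrank_eq_zero.1 h0] at hm
  exact (Submodule.mem_bot ℝ).1 hm

variable {T : Type*} [AddCommGroup T] [Module ℝ T] {i : T →ₗ[ℝ] W} {x : T}

/-- An isotropic vector of a lightlike hyperplane is orthogonal to the hyperplane. -/
theorem isotropic_orthogonal_of_degenerate (hpos : sigPos β.toQuadraticMap + 1 = finrank ℝ W)
    (hs : ∀ u w, β u w = β w u) (hi : Function.Injective i)
    (hdeg : ∃ ζ : T, ζ ≠ 0 ∧ ∀ w, β (i ζ) (i w) = 0) (hx : β (i x) (i x) = 0) (w : T) :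
    β (i x) (i w) = 0 := by
  obtain ⟨ζ, hζ, hζ0⟩ := hdeg
  -- The degenerate vector `ζ` and `x` are isotropic and mutually orthogonal, so `x` is a multiple
  -- of `ζ`.
  have hn := not_linearIndependent_pair_of_nonpos hpos (hζ0 ζ).le hx.le (hζ0 x)
    ((hs _ _).trans (hζ0 x))
  rw [LinearIndependent.pair_iff' ((map_ne_zero_iff i hi).2 hζ)] at hn
  push Not at hn
  obtain ⟨c, hc⟩ := hn
  rw [← hc, map_smul, LinearMap.smul_apply, hζ0, smul_zero]

/-- A vector orthogonal to the isotropic direction of a lightlike hyperplane lies in it. -/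
theorem mem_range_of_orthogonal_isotropic (hpos : sigPos β.toQuadraticMap + 1 = finrank ℝ W)
    (hneg : sigNeg β.toQuadraticMap = 1) (hs : ∀ u w, β u w = β w u)
    (hi : Function.Injective i) (hT : finrank ℝ T + 1 = finrank ℝ W) (hx0 : x ≠ 0)
    (hx : ∀ w, β (i x) (i w) = 0) {y : W} (hy : β (i x) y = 0) : y ∈ LinearMap.range i := by
  have hne : β (i x) ≠ 0 := by
    intro h
    refine (map_ne_zero_iff i hi).2 hx0 (eq_zero_of_lorentzian_of_forall_eq_zero hpos hneg hs ?_)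
    intro w
    rw [h, LinearMap.zero_apply]
  have hk := Module.Dual.finrank_ker_add_one_of_ne_zero (f := β (i x)) hne
  have hle : LinearMap.range i ≤ LinearMap.ker (β (i x)) := by
    rintro _ ⟨w, rfl⟩
    exact hx w
  -- Both are hyperplanes of `W`, so the inclusion is an equality.
  have heq := Submodule.eq_of_le_of_finrank_eq hle (by
    rw [LinearMap.finrank_range_of_inj hi]; omega)
  rw [heq]
  exact hy

/-- On a complement of the isotropic direction in a lightlike hyperplane the form is positive. -/
theorem screen_pos (hpos : sigPos β.toQuadraticMap + 1 = finrank ℝ W)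
    (hs : ∀ u w, β u w = β w u) (hi : Function.Injective i)
    (hx : ∀ w, β (i x) (i w) = 0) {w : T} (hw : LinearIndependent ℝ ![x, w]) :
    0 < β (i w) (i w) := by
  by_contra! h
  refine not_linearIndependent_pair_of_nonpos hpos (hx x).le h (hx w) ((hs _ _).trans (hx w)) ?_
  have h2 : ![i x, i w] = i ∘ ![x, w] := by
    funext j
    fin_cases j <;> rfl
  rw [h2]
  exact hw.map' i (LinearMap.ker_eq_bot.2 hi)

variable {k : ℕ} {e : Fin k → T}

/-- A nontrivial combination of the screen vectors is independent of `x`, so `screen_pos` applies to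
it. -/
theorem screen_posDef (hpos : sigPos β.toQuadraticMap + 1 = finrank ℝ W)
    (hs : ∀ u w, β u w = β w u) (hi : Function.Injective i)
    (hx : ∀ w, β (i x) (i w) = 0)
    (he : LinearIndependent ℝ (Fin.cons x e : Fin (k + 1) → T)) :
    (Matrix.of fun a b ↦ β (i (e a)) (i (e b))).PosDef := by
  refine Matrix.PosDef.of_dotProduct_mulVec_pos ?_ fun c hc ↦ ?_
  · ext a b; simp [hs (i (e a))]
  · have hw : LinearIndependent ℝ ![x, ∑ a, c a • e a] := by
      rw [LinearIndependent.pair_iff]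
      intro s t hst
      have h := Fintype.linearIndependent_iff.1 he (Fin.cons s fun a ↦ t * c a) (by
        simpa [Fin.sum_univ_succ, Finset.smul_sum, smul_smul] using hst)
      refine ⟨by simpa using h 0, ?_⟩
      by_contra ht
      refine hc (funext fun a ↦ ?_)
      simpa [ht] using h a.succ
    have h2 : star c ⬝ᵥ (Matrix.of fun a b ↦ β (i (e a)) (i (e b))).mulVec c
        = β (i (∑ a, c a • e a)) (i (∑ a, c a • e a)) := by
      simp only [dotProduct, Matrix.mulVec, Matrix.of_apply, Pi.star_apply, star_trivial, map_sum,
        map_smul, LinearMap.sum_apply, LinearMap.smul_apply, smul_eq_mul, Finset.mul_sum]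
      rw [Finset.sum_comm]
      refine Finset.sum_congr rfl fun a _ ↦ Finset.sum_congr rfl fun b _ ↦ ?_
      ring
    rw [h2]
    exact screen_pos hpos hs hi hx hw

variable [FiniteDimensional ℝ T] {D : T →ₗ[ℝ] W}

/-- The dimension of the space of displacements of a point of an isotropic line of a lightlike
hypersurface. -/
theorem finrank_displacements (hpos : sigPos β.toQuadraticMap + 1 = finrank ℝ W)
    (hneg : sigNeg β.toQuadraticMap = 1) (hs : ∀ u w, β u w = β w u)
    (hi : Function.Injective i) (hT : finrank ℝ T + 1 = finrank ℝ W)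
    (hx : ∀ w, β (i x) (i w) = 0)
    (hk : finrank ℝ T = k + 1) (he : LinearIndependent ℝ (Fin.cons x e : Fin (k + 1) → T))
    (hD : ∀ a b, β (i a) (D b) = β (i b) (D a)) (hDx : ∀ b, β (i x) (D b) = 0) (p q : ℝ) :
    finrank ℝ (Submodule.span ℝ {w | ∃ (v : T) (σ : ℝ), w = p • i v + q • D v + σ • i x})
      = (p • (1 : Matrix (Fin k) (Fin k) ℝ) + q •
        ((Matrix.of fun a b ↦ β (i (e a)) (i (e b)))⁻¹ *
          Matrix.of fun a b ↦ β (i (e a)) (D (e b)))).rank + 1 := by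
  have hx0 : x ≠ 0 := he.ne_zero 0
  -- As `D v` is orthogonal to the isotropic direction, it is tangent, and `D` becomes an
  -- endomorphism `D'` of `T`.
  have hr : ∀ v, D v ∈ LinearMap.range i := fun v ↦
    mem_range_of_orthogonal_isotropic hpos hneg hs hi hT hx0 hx (hDx v)
  let D' : T →ₗ[ℝ] T := (LinearEquiv.ofInjective i hi).symm.toLinearMap ∘ₗ D.codRestrict _ hr
  have hD' : ∀ v, i (D' v) = D v := fun v ↦ by
    change i ((LinearEquiv.ofInjective i hi).symm ⟨D v, hr v⟩) = _
    rw [← LinearEquiv.ofInjective_apply i (h := hi), LinearEquiv.apply_symm_apply]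
  -- This is what lets `D'` descend to the quotient of `T` by `x`, whose coordinates are given by
  -- `pr` below.
  have hDx' : ∀ a, β (i a) (D x) = 0 := fun a ↦ (hD a x).trans (hDx a)
  let B : Basis (Fin (k + 1)) ℝ T :=
    basisOfLinearIndependentOfCardEqFinrank he (by rw [Fintype.card_fin, hk])
  have hB : ⇑B = Fin.cons x e := coe_basisOfLinearIndependentOfCardEqFinrank he _
  have hB0 : B 0 = x := by rw [hB]; rfl
  have hBs : ∀ a : Fin k, B a.succ = e a := fun a ↦ by rw [hB]; rfl
  let pr : T →ₗ[ℝ] (Fin k → ℝ) := LinearMap.pi fun a ↦ B.coord a.succ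
  have hsum : ∀ v, v = B.repr v 0 • x + ∑ a, pr v a • e a := fun v ↦ by
    conv_lhs => rw [← B.sum_repr v, Fin.sum_univ_succ, hB0]
    simp only [hBs]; rfl
  have hprx : pr x = 0 := by
    funext a; change B.repr x a.succ = 0
    rw [← hB0, B.repr_self, Finsupp.single_eq_of_ne (Fin.succ_ne_zero a)]
  have hprsurj : Function.Surjective pr := fun c ↦ by
    refine ⟨∑ a, c a • e a, ?_⟩
    funext b
    change B.repr _ b.succ = _
    simp only [← hBs, map_sum, map_smul, B.repr_self]
    simp [Finsupp.single_apply, Finsupp.finsetSum_apply]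
  have hker : LinearMap.ker pr = Submodule.span ℝ {x} := by
    ext v
    rw [LinearMap.mem_ker, Submodule.mem_span_singleton]
    constructor
    · intro h
      refine ⟨B.repr v 0, ?_⟩
      conv_rhs => rw [hsum v, h]
      simp
    · rintro ⟨c, rfl⟩
      rw [map_smul, hprx, smul_zero]
  set G : Matrix (Fin k) (Fin k) ℝ := Matrix.of fun a b ↦ β (i (e a)) (i (e b)) with hGdef
  set S : Matrix (Fin k) (Fin k) ℝ := Matrix.of fun a b ↦ β (i (e a)) (D (e b)) with hSdef
  have hG : G.PosDef := screen_posDef hpos hs hi hx he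
  have hGdet : IsUnit G.det := (Matrix.isUnit_iff_isUnit_det _).1 hG.isUnit
  have hGpr : ∀ u a, (G.mulVec (pr u)) a = β (i (e a)) (i u) := fun u a ↦ by
    conv_rhs => rw [hsum u]
    simp [hGdef, Matrix.mulVec, dotProduct, hs (i (e a)) (i x), hx, mul_comm]
  have hSpr : ∀ u a, (S.mulVec (pr u)) a = β (i (e a)) (D u) := fun u a ↦ by
    conv_rhs => rw [hsum u]
    simp [hSdef, Matrix.mulVec, dotProduct, hDx', mul_comm]
  -- `G` and `S` do not see the component along `x`; cancelling `G` identifies the operator induced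
  -- on the quotient with the shape operator.
  have hA : ∀ u, pr (D' u) = (G⁻¹ * S).mulVec (pr u) := fun u ↦ by
    have : G.mulVec (pr (D' u)) = S.mulVec (pr u) := by
      funext a
      rw [hGpr, hSpr, hD']
    rw [← Matrix.mulVec_mulVec, ← this, Matrix.mulVec_mulVec, Matrix.nonsing_inv_mul _ hGdet,
      Matrix.one_mulVec]
  let Φ : T × ℝ →ₗ[ℝ] T := (p • LinearMap.id + q • D').coprod (LinearMap.toSpanSingleton ℝ T x)
  have hΦ : ∀ v σ, Φ (v, σ) = p • v + q • D' v + σ • x := fun v σ ↦ by simp [Φ]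
  have hspan : Submodule.span ℝ {w | ∃ (v : T) (σ : ℝ), w = p • i v + q • D v + σ • i x}
      = (LinearMap.range Φ).map i := by
    have : {w | ∃ (v : T) (σ : ℝ), w = p • i v + q • D v + σ • i x}
        = ((LinearMap.range Φ).map i : Submodule ℝ W) := by
      ext w
      simp only [Set.mem_ofPred_eq, SetLike.mem_coe, Submodule.mem_map, LinearMap.mem_range,
        Prod.exists]
      constructor
      · rintro ⟨v, σ, rfl⟩
        exact ⟨_, ⟨v, σ, rfl⟩, by simp [hΦ, hD']⟩
      · rintro ⟨_, ⟨v, σ, rfl⟩, rfl⟩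
        exact ⟨v, σ, by simp [hΦ, hD']⟩
    rw [this, Submodule.span_eq]
  have hmap : (LinearMap.range Φ).map pr
      = LinearMap.range (p • (1 : Matrix (Fin k) (Fin k) ℝ) + q • (G⁻¹ * S)).mulVecLin := by
    ext c
    simp only [Submodule.mem_map, LinearMap.mem_range, Prod.exists, Matrix.mulVecLin_apply]
    constructor
    · rintro ⟨_, ⟨v, σ, rfl⟩, rfl⟩
      refine ⟨pr v, ?_⟩
      simp [hΦ, hprx, hA, Matrix.add_mulVec, Matrix.smul_mulVec]
    · rintro ⟨c, rfl⟩
      obtain ⟨v, rfl⟩ := hprsurj c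
      refine ⟨_, ⟨v, 0, rfl⟩, ?_⟩
      simp [hΦ, hA, Matrix.add_mulVec, Matrix.smul_mulVec]
  have hxU : Submodule.span ℝ {x} ≤ LinearMap.range Φ := by
    rw [Submodule.span_singleton_le_iff_mem]
    exact ⟨(0, 1), by simp [hΦ]⟩
  -- The displacements contain the line of `x`, which `pr` kills; this line is the `+ 1` of the
  -- formula.
  have hkerU : finrank ℝ (LinearMap.ker (pr.domRestrict (LinearMap.range Φ))) = 1 := by
    rw [LinearMap.ker_domRestrict, ← Submodule.finrank_map_subtype_eq,
      Submodule.map_comap_subtype, hker, inf_eq_right.2 hxU, finrank_span_singleton hx0]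
  have hrn := LinearMap.finrank_range_add_finrank_ker (pr.domRestrict (LinearMap.range Φ))
  rw [hkerU, LinearMap.range_domRestrict, hmap] at hrn
  rw [hspan, ← (Submodule.equivMapOfInjective i hi _).finrank_eq, ← hrn]
  rfl

end LorentzianSpace

/-! ### Counting singular points on the completed line -/

section SingularPoints

variable {k : ℕ} {L : Matrix (Fin k) (Fin k) ℝ} {P : (Matrix (Fin k) (Fin k) ℝ)ˣ} {d : Fin k → ℝ}
  {dim : OnePoint ℝ → ℕ}

theorem singularMultiplicity_add_dim (h : L = P.1 * Matrix.diagonal d * P⁻¹.1)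
    (h0 : dim OnePoint.infty = ((0 : ℝ) • (1 : Matrix (Fin k) (Fin k) ℝ) + (1 : ℝ) • L).rank + 1)
    (h1 : ∀ s : ℝ, dim s = ((1 : ℝ) • (1 : Matrix (Fin k) (Fin k) ℝ) + s • L).rank + 1)
    (y : OnePoint ℝ) : singularMultiplicity L y + dim y = k + 1 := by
  rw [singularMultiplicity_of_diagonalization h]
  cases y with
  | infty =>
    have := rank_pencil_of_diagonalization h 0 1
    simp only [focus_eq_infty_iff]
    simp only [zero_add, one_mul] at this
    rw [h0]; omega
  | coe s =>
    have := rank_pencil_of_diagonalization h 1 s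
    simp only [focus_eq_coe_iff]
    rw [h1]; omega

/-- The dimension drops exactly when the multiplicity is positive, that is, when some focus falls on
the point. -/
theorem setOf_dim_lt_eq_range_focus (h : L = P.1 * Matrix.diagonal d * P⁻¹.1)
    (hdim : ∀ y, singularMultiplicity L y + dim y = k + 1) :
    {y | dim y < k + 1} = Set.range fun a ↦ focus (d a) := by
  ext y
  have h1 : dim y < k + 1 ↔ 0 < singularMultiplicity L y := by have := hdim y; omega
  rw [Set.mem_ofPred_eq, h1, singularMultiplicity_of_diagonalization h,
    Set.ncard_pos (Set.toFinite _)]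
  rfl

/-- The multiplicities are the sizes of the fibres of $a\mapsto F_a$, which partition the $k$
indices. -/
theorem finsum_singularMultiplicity (h : L = P.1 * Matrix.diagonal d * P⁻¹.1) :
    ∑ᶠ y ∈ Set.range fun a ↦ focus (d a), singularMultiplicity L y = k := by
  classical
  have h1 : (Set.range fun a ↦ focus (d a)) = ↑(Finset.univ.image fun a ↦ focus (d a)) := by simp
  rw [h1, finsum_mem_coe_finset]
  have h2 := Finset.card_eq_sum_card_image (fun a ↦ focus (d a)) (Finset.univ : Finset (Fin k))
  rw [Finset.card_univ, Fintype.card_fin] at h2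
  refine Eq.trans (Finset.sum_congr rfl fun y _ ↦ ?_) h2.symm
  rw [singularMultiplicity_of_diagonalization h, Set.ncard_eq_toFinset_card', Set.toFinset_ofPred]

end SingularPoints

/-! ### The metric in a chart -/

section Charts

variable {E : Type*} [NormedAddCommGroup E] [NormedSpace ℝ E]
  {M : Type*} [TopologicalSpace M] [ChartedSpace E M] [IsManifold 𝓘(ℝ, E) ∞ M]

/-- The differential of the chart centred at `x₀`, with values in the model space. -/
def chartDeriv (x₀ q : M) : TangentSpace 𝓘(ℝ, E) q →L[ℝ] E :=
  mfderiv 𝓘(ℝ, E) 𝓘(ℝ, E) (extChartAt 𝓘(ℝ, E) x₀) q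

/-- The differential of the inverse of the chart centred at `x₀`, defined on the model space. -/
def chartSymmDeriv (x₀ : M) (y : E) :
    E →L[ℝ] TangentSpace 𝓘(ℝ, E) ((extChartAt 𝓘(ℝ, E) x₀).symm y) :=
  mfderiv 𝓘(ℝ, E) 𝓘(ℝ, E) (extChartAt 𝓘(ℝ, E) x₀).symm y

theorem chartSymmDeriv_chartDeriv {x₀ : M} {y : E}
    (hy : y ∈ (extChartAt 𝓘(ℝ, E) x₀).target)
    (v : TangentSpace 𝓘(ℝ, E) ((extChartAt 𝓘(ℝ, E) x₀).symm y)) :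
    chartSymmDeriv x₀ y (chartDeriv x₀ ((extChartAt 𝓘(ℝ, E) x₀).symm y) v) = v := by
  have h := mfderivWithin_extChartAt_symm_comp_mfderiv_extChartAt (I := 𝓘(ℝ, E)) hy
  rw [modelWithCornersSelf_coe, Set.range_id, mfderivWithin_univ] at h
  exact DFunLike.congr_fun h v

theorem chartDeriv_chartSymmDeriv {x₀ : M} {y : E}
    (hy : y ∈ (extChartAt 𝓘(ℝ, E) x₀).target) (u : E) :
    chartDeriv x₀ ((extChartAt 𝓘(ℝ, E) x₀).symm y) (chartSymmDeriv x₀ y u) = u := by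
  have h := mfderiv_extChartAt_comp_mfderivWithin_extChartAt_symm (I := 𝓘(ℝ, E)) hy
  rw [modelWithCornersSelf_coe, Set.range_id, mfderivWithin_univ] at h
  exact DFunLike.congr_fun h u

theorem isInvertible_chartDeriv {x₀ q : M} (hq : q ∈ (extChartAt 𝓘(ℝ, E) x₀).source) :
    (chartDeriv (E := E) x₀ q).IsInvertible :=
  isInvertible_mfderiv_extChartAt (I := 𝓘(ℝ, E)) hq

namespace LorentzianMetric

variable (g : LorentzianMetric E M)

theorem inChart_apply (x₀ : M) (y u v : E) :
    g.inChart x₀ y u v = g.inner ((extChartAt 𝓘(ℝ, E) x₀).symm y)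
      (chartSymmDeriv x₀ y u)
      (chartSymmDeriv x₀ y v) := rfl

theorem inChart_symm (x₀ : M) (y u v : E) : g.inChart x₀ y u v = g.inChart x₀ y v u := by
  rw [inChart_apply, inChart_apply, g.symm]

theorem inChart_mfderiv {x₀ q : M} (hq : q ∈ (extChartAt 𝓘(ℝ, E) x₀).source)
    (v w : TangentSpace 𝓘(ℝ, E) q) :
    g.inChart x₀ (extChartAt 𝓘(ℝ, E) x₀ q)
      (chartDeriv x₀ q v)
      (chartDeriv x₀ q w) = g.inner q v w := by
  obtain ⟨y, hy, rfl⟩ : ∃ y ∈ (extChartAt 𝓘(ℝ, E) x₀).target,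
      (extChartAt 𝓘(ℝ, E) x₀).symm y = q :=
    ⟨_, (extChartAt 𝓘(ℝ, E) x₀).map_source hq, (extChartAt 𝓘(ℝ, E) x₀).left_inv hq⟩
  rw [(extChartAt 𝓘(ℝ, E) x₀).right_inv hy, inChart_apply,
    chartSymmDeriv_chartDeriv hy, chartSymmDeriv_chartDeriv hy]

/-- The scalar product at a point, as a bilinear map. -/
def bilin (x : M) : LinearMap.BilinMap ℝ (TangentSpace 𝓘(ℝ, E) x) ℝ :=
  LinearMap.mk₂ ℝ (fun v w : TangentSpace 𝓘(ℝ, E) x ↦ g.inner x v w)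
      (by simp) (by simp) (by simp) (by simp)

/-- Vectors constant in a trivialization are smooth sections, so the coefficients of the metric in
it are smooth. -/
theorem contMDiffOn_inner_symmL (x₀ : M) (u v : E) :
    ContMDiffOn 𝓘(ℝ, E) 𝓘(ℝ, ℝ) ∞ (fun x ↦ g.inner x
      ((trivializationAt E (TangentSpace 𝓘(ℝ, E)) x₀).symmL ℝ x u)
      ((trivializationAt E (TangentSpace 𝓘(ℝ, E)) x₀).symmL ℝ x v))
      (trivializationAt E (TangentSpace 𝓘(ℝ, E)) x₀).baseSet := by
  intro x hx
  have hsec : ∀ w : E, ContMDiffAt 𝓘(ℝ, E) (𝓘(ℝ, E).prod 𝓘(ℝ, E)) ∞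
      (fun x ↦ TotalSpace.mk' E (E := TangentSpace 𝓘(ℝ, E)) x
        ((trivializationAt E (TangentSpace 𝓘(ℝ, E)) x₀).symmL ℝ x w)) x := fun w ↦ by
    have hw : ContMDiffAt 𝓘(ℝ, E) (𝓘(ℝ, E).prod 𝓘(ℝ, E)) ∞
        (fun x : M ↦ TotalSpace.mk' E (E := Bundle.Trivial M E) x w) x := by
      rw [contMDiffAt_totalSpace]
      exact ⟨contMDiffAt_id, contMDiffAt_const⟩
    exact ((trivializationAt E (TangentSpace 𝓘(ℝ, E)) x₀).contMDiffAt_symmL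
      (n := ∞) (IB := 𝓘(ℝ, E)) hx).clm_bundle_apply hw
  have : ContMDiffAt 𝓘(ℝ, E) (𝓘(ℝ, E).prod 𝓘(ℝ, ℝ)) ∞
      (fun x ↦ TotalSpace.mk' ℝ (E := Bundle.Trivial M ℝ) x (g.inner x
      ((trivializationAt E (TangentSpace 𝓘(ℝ, E)) x₀).symmL ℝ x u)
      ((trivializationAt E (TangentSpace 𝓘(ℝ, E)) x₀).symmL ℝ x v))) x :=
    ContMDiffAt.clm_bundle_apply₂ (F₁ := E) (F₂ := E) g.contMDiff.contMDiffAt (hsec u) (hsec v)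
  rw [contMDiffAt_totalSpace] at this
  exact this.2.contMDiffWithinAt

variable [FiniteDimensional ℝ E]

instance (x : M) : FiniteDimensional ℝ (TangentSpace 𝓘(ℝ, E) x) :=
  inferInstanceAs (FiniteDimensional ℝ E)

theorem eq_zero_of_forall_inner_eq_zero {x : M} {v : TangentSpace 𝓘(ℝ, E) x}
    (h : ∀ w, g.inner x v w = 0) : v = 0 :=
  eq_zero_of_lorentzian_of_forall_eq_zero (β := g.bilin x) (g.sigPos_add_one x)
    (g.sigNeg_eq_one x) (g.symm x) h

/-- Nondegeneracy gives injectivity, and the dimensions agree. Invertibility matters because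
`inverse` in `christoffel` is zero by default on noninvertible maps. -/
theorem isInvertible_inChart {x₀ : M} {y : E} (hy : y ∈ (extChartAt 𝓘(ℝ, E) x₀).target) :
    (g.inChart x₀ y).IsInvertible := by
  have hinj : Function.Injective (g.inChart x₀ y) := by
    rw [injective_iff_map_eq_zero]
    intro u hu
    have h0 : chartSymmDeriv x₀ y u = 0 := by
      refine g.eq_zero_of_forall_inner_eq_zero fun w ↦ ?_
      rw [← chartSymmDeriv_chartDeriv hy w, ← inChart_apply, hu]
      rfl
    rw [← chartDeriv_chartSymmDeriv hy u, h0, map_zero]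
  have hdim : finrank ℝ E = finrank ℝ (E →L[ℝ] ℝ) := by
    rw [← LinearEquiv.finrank_eq (LinearMap.toContinuousLinearMap (𝕜 := ℝ) (E := E) (F' := ℝ))]
    exact (Subspace.dual_finrank_eq).symm
  refine ⟨(LinearEquiv.ofInjectiveOfFinrankEq (g.inChart x₀ y).toLinearMap hinj
    hdim).toContinuousLinearEquiv, ?_⟩
  ext u v
  rfl

theorem contDiffOn_inChart (x₀ : M) :
    ContDiffOn ℝ ∞ (g.inChart x₀) (extChartAt 𝓘(ℝ, E) x₀).target := by
  rw [contDiffOn_clm_apply]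
  intro u
  rw [contDiffOn_clm_apply]
  intro v
  rw [← contMDiffOn_iff_contDiffOn]
  refine ((g.contMDiffOn_inner_symmL x₀ u v).comp
    (contMDiffOn_extChartAt_symm (I := 𝓘(ℝ, E)) (n := ∞) x₀) fun y hy ↦ ?_).congr fun y hy ↦ ?_
  · rw [Set.mem_preimage, TangentBundle.trivializationAt_baseSet,
      ← extChartAt_source (I := 𝓘(ℝ, E))]
    exact (extChartAt 𝓘(ℝ, E) x₀).map_target hy
  · have hs : (extChartAt 𝓘(ℝ, E) x₀).symm y ∈ (chartAt E x₀).source := by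
      rw [← extChartAt_source (I := 𝓘(ℝ, E))]
      exact (extChartAt 𝓘(ℝ, E) x₀).map_target hy
    rw [Function.comp_apply, TangentBundle.symmL_trivializationAt hs,
      (extChartAt 𝓘(ℝ, E) x₀).right_inv hy, modelWithCornersSelf_coe, Set.range_id,
      mfderivWithin_univ]
    rfl

theorem differentiableAt_inChart (x₀ : M) :
    DifferentiableAt ℝ (g.inChart x₀) (extChartAt 𝓘(ℝ, E) x₀ x₀) :=
  ((g.contDiffOn_inChart x₀).contDiffAt (extChartAt_target_mem_nhds x₀)).differentiableAt
    (by simp)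

end LorentzianMetric

end Charts

/-! ### A hypersurface and a tangent field in charts -/

section LocalRepresentation

variable {E : Type*} [NormedAddCommGroup E] [NormedSpace ℝ E]
  {M : Type*} [TopologicalSpace M] [ChartedSpace E M]
  {F : Type*} [NormedAddCommGroup F] [NormedSpace ℝ F]
  {N : Type*} [TopologicalSpace N] [ChartedSpace F N]

variable (E F) in
/-- A map between manifolds, in the charts centred at `p` and at its image. -/
def localRep (ι : N → M) (p : N) : F → E :=
  extChartAt 𝓘(ℝ, E) (ι p) ∘ ι ∘ (extChartAt 𝓘(ℝ, F) p).symm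

/-- A vector field in the chart centred at `p`. -/
def localField (ξ : (q : N) → TangentSpace 𝓘(ℝ, F) q) (p : N) (z : F) : F :=
  chartDeriv p ((extChartAt 𝓘(ℝ, F) p).symm z) (ξ ((extChartAt 𝓘(ℝ, F) p).symm z))

/-- The image of a vector field under the differential of a map, in charts. -/
def localPush (ι : N → M) (ξ : (q : N) → TangentSpace 𝓘(ℝ, F) q) (p : N) (z : F) : E :=
  fderiv ℝ (localRep E F ι p) z (localField ξ p z)

theorem localRep_center (ι : N → M) (p : N) :
    localRep E F ι p (extChartAt 𝓘(ℝ, F) p p) = extChartAt 𝓘(ℝ, E) (ι p) (ι p) := by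
  simp [localRep]

theorem localRep_apply_chart (ι : N → M) {p q : N} (hq : q ∈ (extChartAt 𝓘(ℝ, F) p).source) :
    localRep E F ι p (extChartAt 𝓘(ℝ, F) p q) = extChartAt 𝓘(ℝ, E) (ι p) (ι q) := by
  rw [localRep, Function.comp_apply, Function.comp_apply, (extChartAt 𝓘(ℝ, F) p).left_inv hq]

theorem localField_apply_chart (ξ : (q : N) → TangentSpace 𝓘(ℝ, F) q) {p q : N}
    (hq : q ∈ (extChartAt 𝓘(ℝ, F) p).source) :
    localField ξ p (extChartAt 𝓘(ℝ, F) p q) = chartDeriv p q (ξ q) :=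
  congrArg (fun q' ↦ (chartDeriv p q' (ξ q') : F)) ((extChartAt 𝓘(ℝ, F) p).left_inv hq)

theorem contDiffAt_localRep {ι : N → M} (hι : ContMDiff 𝓘(ℝ, F) 𝓘(ℝ, E) ∞ ι) (p : N) :
    ContDiffAt ℝ ∞ (localRep E F ι p) (extChartAt 𝓘(ℝ, F) p p) := by
  have h := (contMDiffAt_iff.1 (hι p)).2
  rw [modelWithCornersSelf_coe, Set.range_id, contDiffWithinAt_univ] at h
  exact h

theorem eventually_mem_charts {ι : N → M} {p : N} (hι : ContinuousAt ι p) :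
    ∀ᶠ q in 𝓝 p, q ∈ (extChartAt 𝓘(ℝ, F) p).source ∧
      ι q ∈ (extChartAt 𝓘(ℝ, E) (ι p)).source :=
  Filter.Eventually.and (extChartAt_source_mem_nhds (I := 𝓘(ℝ, F)) p)
    (hι (extChartAt_source_mem_nhds (I := 𝓘(ℝ, E)) (ι p)))

variable [IsManifold 𝓘(ℝ, F) ∞ N]

/-- The tangent bundle trivialization at `p` is the derivative of the chart, so smoothness of the
section is smoothness of its coordinates. -/
theorem differentiableAt_localField {ξ : (q : N) → TangentSpace 𝓘(ℝ, F) q} {p : N}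
    (hξ : ContMDiffAt 𝓘(ℝ, F) 𝓘(ℝ, F).tangent ∞
      (fun q ↦ (⟨q, ξ q⟩ : TangentBundle 𝓘(ℝ, F) N)) p) :
    DifferentiableAt ℝ (localField ξ p) (extChartAt 𝓘(ℝ, F) p p) := by
  have h1 : ContMDiffAt 𝓘(ℝ, F) 𝓘(ℝ, F) ∞ (fun q ↦ (chartDeriv p q (ξ q) : F)) p := by
    refine ((contMDiffAt_section p).1 hξ).congr_of_eventuallyEq ?_
    filter_upwards [extChartAt_source_mem_nhds (I := 𝓘(ℝ, F)) p] with q hq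
    rw [extChartAt_source] at hq
    have h := TangentBundle.continuousLinearMapAt_trivializationAt (I := 𝓘(ℝ, F)) hq
    have h' := DFunLike.congr_fun h (ξ q)
    refine Eq.trans h'.symm ?_
    rw [Trivialization.continuousLinearMapAt_apply, Trivialization.coe_linearMapAt_of_mem]
    rwa [TangentBundle.trivializationAt_baseSet]
  have h2 := (contMDiffAt_iff.1 h1).2
  rw [modelWithCornersSelf_coe, Set.range_id, contDiffWithinAt_univ] at h2
  exact h2.differentiableAt (by simp)

theorem differentiableAt_localPush {ι : N → M} (hι : ContMDiff 𝓘(ℝ, F) 𝓘(ℝ, E) ∞ ι)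
    {ξ : (q : N) → TangentSpace 𝓘(ℝ, F) q} {p : N}
    (hξ : ContMDiffAt 𝓘(ℝ, F) 𝓘(ℝ, F).tangent ∞
      (fun q ↦ (⟨q, ξ q⟩ : TangentBundle 𝓘(ℝ, F) N)) p) :
    DifferentiableAt ℝ (localPush (E := E) ι ξ p) (extChartAt 𝓘(ℝ, F) p p) :=
  DifferentiableAt.clm_apply
    (((contDiffAt_localRep hι p).fderiv_right (m := 1) (by norm_cast)).differentiableAt (by simp))
    (differentiableAt_localField hξ)

variable [IsManifold 𝓘(ℝ, E) ∞ M]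

theorem fderiv_localRep {ι : N → M} (hι : ContMDiff 𝓘(ℝ, F) 𝓘(ℝ, E) ∞ ι) (p : N) :
    ∀ᶠ q in 𝓝 p, ∀ v : TangentSpace 𝓘(ℝ, F) q,
      fderiv ℝ (localRep E F ι p) (extChartAt 𝓘(ℝ, F) p q) (chartDeriv p q v)
        = chartDeriv (ι p) (ι q) (mfderiv 𝓘(ℝ, F) 𝓘(ℝ, E) ι q v) := by
  have h1 : ∀ᶠ z in 𝓝 (extChartAt 𝓘(ℝ, F) p p), DifferentiableAt ℝ (localRep E F ι p) z :=
    (((contDiffAt_localRep hι p).of_le (m := 1) (by simp)).eventually (by simp)).mono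
      fun z hz ↦ hz.differentiableAt (by simp)
  filter_upwards [(continuousAt_extChartAt p).eventually h1,
    -- Comparing derivatives at `q` needs the two maps to agree on a whole neighbourhood of `q`.
    (eventually_mem_charts (E := E) (F := F) hι.continuous.continuousAt).eventually_nhds]
    with q hd hev v
  obtain ⟨hq, hιq⟩ := hev.self_of_nhds
  have hψ : MDifferentiableAt 𝓘(ℝ, F) 𝓘(ℝ, F) (extChartAt 𝓘(ℝ, F) p) q :=
    mdifferentiableAt_extChartAt (by rwa [extChartAt_source] at hq)
  have hφ : MDifferentiableAt 𝓘(ℝ, E) 𝓘(ℝ, E) (extChartAt 𝓘(ℝ, E) (ι p)) (ι q) :=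
    mdifferentiableAt_extChartAt (by rwa [extChartAt_source] at hιq)
  have heq : localRep E F ι p ∘ extChartAt 𝓘(ℝ, F) p =ᶠ[𝓝 q] extChartAt 𝓘(ℝ, E) (ι p) ∘ ι :=
    hev.mono fun q' hq' ↦ localRep_apply_chart ι hq'.1
  have h2 := heq.mfderiv_eq (I := 𝓘(ℝ, F)) (I' := 𝓘(ℝ, E))
  rw [mfderiv_comp q hd.mdifferentiableAt hψ,
    mfderiv_comp q hφ (hι.mdifferentiableAt (by simp)), mfderiv_eq_fderiv] at h2
  exact DFunLike.congr_fun h2 v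

theorem localPush_apply_chart {ι : N → M} (hι : ContMDiff 𝓘(ℝ, F) 𝓘(ℝ, E) ∞ ι)
    (ξ : (q : N) → TangentSpace 𝓘(ℝ, F) q) (p : N) :
    ∀ᶠ q in 𝓝 p, localPush ι ξ p (extChartAt 𝓘(ℝ, F) p q)
      = chartDeriv (E := E) (ι p) (ι q) (isotropicVector ι ξ q) := by
  filter_upwards [fderiv_localRep (E := E) hι p,
    extChartAt_source_mem_nhds (I := 𝓘(ℝ, F)) p] with q hq hs
  rw [localPush, localField_apply_chart ξ hs, hq, isotropicVector]

/-- The covariant differential of the field `e₁` in charts. -/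
theorem chartDeriv_dIsotropicVector (g : LorentzianMetric E M) {ι : N → M}
    (hι : ContMDiff 𝓘(ℝ, F) 𝓘(ℝ, E) ∞ ι)
    {ξ : (q : N) → TangentSpace 𝓘(ℝ, F) q} {p : N}
    (hξ : ContMDiffAt 𝓘(ℝ, F) 𝓘(ℝ, F).tangent ∞
      (fun q ↦ (⟨q, ξ q⟩ : TangentBundle 𝓘(ℝ, F) N)) p) (v : TangentSpace 𝓘(ℝ, F) p) :
    chartDeriv (ι p) (ι p) (dIsotropicVector g ι ξ p v)
      = fderiv ℝ (localPush ι ξ p) (extChartAt 𝓘(ℝ, F) p p) (chartDeriv p p v)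
        + g.christoffel (ι p) (extChartAt 𝓘(ℝ, E) (ι p) (ι p))
          (fderiv ℝ (localRep E F ι p) (extChartAt 𝓘(ℝ, F) p p) (chartDeriv p p v))
          (localPush ι ξ p (extChartAt 𝓘(ℝ, F) p p)) := by
  have h1 := localPush_apply_chart (E := E) hι ξ p
  have heq : (fun q ↦ (chartDeriv (E := E) (ι p) (ι q) (isotropicVector ι ξ q) : E))
      =ᶠ[𝓝 p] localPush ι ξ p ∘ extChartAt 𝓘(ℝ, F) p := h1.mono fun q hq ↦ hq.symm
  have h2 := heq.mfderiv_eq (I := 𝓘(ℝ, F)) (I' := 𝓘(ℝ, E))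
  rw [mfderiv_comp p (differentiableAt_localPush hι hξ).mdifferentiableAt
    (mdifferentiableAt_extChartAt (mem_chart_source F p)), mfderiv_eq_fderiv] at h2
  have h3 := DFunLike.congr_fun h2 v
  rw [h1.self_of_nhds, (fderiv_localRep hι p).self_of_nhds]
  have hinv := (isInvertible_chartDeriv (E := E)
    (mem_extChartAt_source (I := 𝓘(ℝ, E)) (ι p))).self_apply_inverse
  refine (hinv _).trans ?_
  congr 1

end LocalRepresentation

/-! ### The second fundamental form of a lightlike hypersurface -/

section LightlikeHyperplane

variable {E : Type*} [NormedAddCommGroup E] [NormedSpace ℝ E] [FiniteDimensional ℝ E]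
  {M : Type*} [TopologicalSpace M] [ChartedSpace E M] [IsManifold 𝓘(ℝ, E) ∞ M]
  {F : Type*} [NormedAddCommGroup F] [NormedSpace ℝ F]
  {N : Type*} [TopologicalSpace N] [ChartedSpace F N] {g : LorentzianMetric E M} {ι : N → M}

/-- An isotropic field of a lightlike hypersurface is orthogonal to the hypersurface. -/
theorem IsLightlikeHypersurface.orthogonal_of_isotropic
    (hV : IsLightlikeHypersurface (F := F) g ι) {q : N}
    {ζ : TangentSpace 𝓘(ℝ, F) q} (hζ : g.inner (ι q) (mfderiv 𝓘(ℝ, F) 𝓘(ℝ, E) ι q ζ)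
      (mfderiv 𝓘(ℝ, F) 𝓘(ℝ, E) ι q ζ) = 0) (w : TangentSpace 𝓘(ℝ, F) q) :
    g.inner (ι q) (mfderiv 𝓘(ℝ, F) 𝓘(ℝ, E) ι q ζ) (mfderiv 𝓘(ℝ, F) 𝓘(ℝ, E) ι q w) = 0 :=
  isotropic_orthogonal_of_degenerate (β := g.bilin (ι q))
    (i := (mfderiv 𝓘(ℝ, F) 𝓘(ℝ, E) ι q).toLinearMap) (g.sigPos_add_one (ι q)) (g.symm (ι q))
    (hV.injective q) (hV.degenerate q) hζ w

end LightlikeHyperplane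

section SecondFundamentalForm

variable {E : Type*} [NormedAddCommGroup E] [NormedSpace ℝ E]
  {M : Type*} [TopologicalSpace M] [ChartedSpace E M] [IsManifold 𝓘(ℝ, E) ∞ M]
  {F : Type*} [NormedAddCommGroup F] [NormedSpace ℝ F]
  {N : Type*} [TopologicalSpace N] [ChartedSpace F N] [IsManifold 𝓘(ℝ, F) ∞ N]

-- Linearity in the direction slot makes $v\mapsto\nabla_v e_1$ a linear map.
set_option synthInstance.maxHeartbeats 200000 in
theorem LorentzianMetric.christoffel_add (g : LorentzianMetric E M) (x₀ : M) (y u u' v : E) :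
    g.christoffel x₀ y (u + u') v = g.christoffel x₀ y u v + g.christoffel x₀ y u' v := by
  simp only [LorentzianMetric.christoffel]
  rw [← map_add, ← smul_add]
  congr 2
  ext w
  simp
  ring

set_option synthInstance.maxHeartbeats 200000 in
theorem LorentzianMetric.christoffel_smul (g : LorentzianMetric E M) (x₀ : M) (y : E) (c : ℝ)
    (u v : E) : g.christoffel x₀ y (c • u) v = c • g.christoffel x₀ y u v := by
  simp only [LorentzianMetric.christoffel]
  rw [← map_smul, smul_comm c]
  congr 2
  ext w
  simp
  ring

set_option synthInstance.maxHeartbeats 200000 in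
theorem LorentzianMetric.two_mul_inChart_christoffel [FiniteDimensional ℝ E]
    (g : LorentzianMetric E M) {x₀ : M} {y : E}
    (hy : y ∈ (extChartAt 𝓘(ℝ, E) x₀).target) (u v w : E) :
    2 * g.inChart x₀ y (g.christoffel x₀ y u v) w = fderiv ℝ (g.inChart x₀) y u v w
      + fderiv ℝ (g.inChart x₀) y v u w - fderiv ℝ (g.inChart x₀) y w u v := by
  simp only [LorentzianMetric.christoffel]
  rw [(g.isInvertible_inChart hy).self_apply_inverse]
  simp

variable {g : LorentzianMetric E M} {ι : N → M} {ξ : (q : N) → TangentSpace 𝓘(ℝ, F) q} {p : N}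

/-- The covariant differential of the field `e₁` at a point, as a linear map. -/
def dIsotropicVectorLinear (g : LorentzianMetric E M) (hι : ContMDiff 𝓘(ℝ, F) 𝓘(ℝ, E) ∞ ι)
    (hξ : ContMDiffAt 𝓘(ℝ, F) 𝓘(ℝ, F).tangent ∞
      (fun q ↦ (⟨q, ξ q⟩ : TangentBundle 𝓘(ℝ, F) N)) p) :
    TangentSpace 𝓘(ℝ, F) p →ₗ[ℝ] TangentSpace 𝓘(ℝ, E) (ι p) where
  toFun := dIsotropicVector g ι ξ p
  map_add' v w := by
    refine (isInvertible_chartDeriv (E := E)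
      (mem_extChartAt_source (I := 𝓘(ℝ, E)) (ι p))).injective ?_
    rw [map_add]
    simp only [chartDeriv_dIsotropicVector g hι hξ, map_add, g.christoffel_add]
    abel
  map_smul' c v := by
    refine (isInvertible_chartDeriv (E := E)
      (mem_extChartAt_source (I := 𝓘(ℝ, E)) (ι p))).injective ?_
    rw [RingHom.id_apply, map_smul]
    simp only [chartDeriv_dIsotropicVector g hι hξ, map_smul, g.christoffel_smul, smul_add]

/-- Brings the second fundamental form to the coordinate expression treated by
`local_second_form_symm` and `local_second_form_null`. -/
theorem inner_dIsotropicVector (hι : ContMDiff 𝓘(ℝ, F) 𝓘(ℝ, E) ∞ ι)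
    (hξ : ContMDiffAt 𝓘(ℝ, F) 𝓘(ℝ, F).tangent ∞
      (fun q ↦ (⟨q, ξ q⟩ : TangentBundle 𝓘(ℝ, F) N)) p) (a b : TangentSpace 𝓘(ℝ, F) p) :
    g.inner (ι p) (mfderiv 𝓘(ℝ, F) 𝓘(ℝ, E) ι p a) (dIsotropicVector g ι ξ p b)
      = g.inChart (ι p) (localRep E F ι p (extChartAt 𝓘(ℝ, F) p p))
        (fderiv ℝ (localRep E F ι p) (extChartAt 𝓘(ℝ, F) p p) (chartDeriv p p a))
        (fderiv ℝ (localPush ι ξ p) (extChartAt 𝓘(ℝ, F) p p) (chartDeriv p p b)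
          + g.christoffel (ι p) (localRep E F ι p (extChartAt 𝓘(ℝ, F) p p))
          (fderiv ℝ (localRep E F ι p) (extChartAt 𝓘(ℝ, F) p p) (chartDeriv p p b))
          (localPush ι ξ p (extChartAt 𝓘(ℝ, F) p p))) := by
  rw [localRep_center, ← chartDeriv_dIsotropicVector g hι hξ,
    (fderiv_localRep (E := E) hι p).self_of_nhds, g.inChart_mfderiv (mem_extChartAt_source _)]

variable [FiniteDimensional ℝ E]

/-- The field is orthogonal to the tangent hyperplane at every nearby point, not only at `p`, so the
identity may be differentiated. -/
theorem eventually_localPush_orthogonal (hV : IsLightlikeHypersurface (F := F) g ι)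
    (hξ : IsIsotropicFieldAt g ι ξ p) :
    ∀ᶠ z in 𝓝 (extChartAt 𝓘(ℝ, F) p p), ∀ a, g.inChart (ι p) (localRep E F ι p z)
      (fderiv ℝ (localRep E F ι p) z a)
      (fderiv ℝ (localRep E F ι p) z (localField ξ p z)) = 0 := by
  have h1 : ∀ᶠ q in 𝓝 p, ∀ a : F, g.inChart (ι p)
      (localRep E F ι p (extChartAt 𝓘(ℝ, F) p q))
      (fderiv ℝ (localRep E F ι p) (extChartAt 𝓘(ℝ, F) p q) a)
      (fderiv ℝ (localRep E F ι p) (extChartAt 𝓘(ℝ, F) p q)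
        (localField ξ p (extChartAt 𝓘(ℝ, F) p q))) = 0 := by
    filter_upwards [hξ.isotropic, fderiv_localRep (E := E) hV.contMDiff p,
      eventually_mem_charts (E := E) (F := F) hV.contMDiff.continuous.continuousAt]
      with q hq hf hs a
    obtain ⟨v, rfl⟩ := (isInvertible_chartDeriv (E := F) hs.1).surjective a
    rw [localField_apply_chart ξ hs.1, hf, hf, localRep_apply_chart ι hs.1,
      g.inChart_mfderiv hs.2, g.symm]
    exact hV.orthogonal_of_isotropic hq v
  have h2 : Filter.Tendsto (extChartAt 𝓘(ℝ, F) p).symm (𝓝 (extChartAt 𝓘(ℝ, F) p p)) (𝓝 p) := by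
    have := continuousAt_extChartAt_symm (I := 𝓘(ℝ, F)) p
    rwa [ContinuousAt, (extChartAt 𝓘(ℝ, F) p).left_inv (mem_extChartAt_source p)] at this
  filter_upwards [h2.eventually h1, extChartAt_target_mem_nhds (I := 𝓘(ℝ, F)) p] with z hz ht
  rwa [(extChartAt 𝓘(ℝ, F) p).right_inv ht] at hz

/-- The second fundamental form `(a, b) ↦ g (a, ∇_b e₁)` of a lightlike hypersurface is
symmetric. -/
theorem second_fundamental_form_symm (hV : IsLightlikeHypersurface (F := F) g ι)
    (hξ : IsIsotropicFieldAt g ι ξ p) (a b : TangentSpace 𝓘(ℝ, F) p) :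
    g.inner (ι p) (mfderiv 𝓘(ℝ, F) 𝓘(ℝ, E) ι p a) (dIsotropicVector g ι ξ p b)
      = g.inner (ι p) (mfderiv 𝓘(ℝ, F) 𝓘(ℝ, E) ι p b) (dIsotropicVector g ι ξ p a) := by
  rw [inner_dIsotropicVector hV.contMDiff hξ.contMDiffAt,
    inner_dIsotropicVector hV.contMDiff hξ.contMDiffAt]
  refine local_second_form_symm ((contDiffAt_localRep hV.contMDiff p).of_le (by norm_cast)) ?_
    (differentiableAt_localField hξ.contMDiffAt) (g.inChart_symm (ι p))
    (eventually_localPush_orthogonal hV hξ) ?_ _ _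
  · rw [localRep_center]
    exact g.differentiableAt_inChart (ι p)
  · rw [localRep_center]
    exact g.two_mul_inChart_christoffel (mem_extChartAt_target (ι p))

/-- The covariant derivatives of an isotropic field are orthogonal to it. With the symmetry of the
second fundamental form this shows that `∇_{e₁} e₁` is orthogonal to the hypersurface, hence
proportional to `e₁`: the integral curves of the field are geodesics. -/
theorem inner_isotropicVector_dIsotropicVector (hV : IsLightlikeHypersurface (F := F) g ι)
    (hξ : IsIsotropicFieldAt g ι ξ p) (b : TangentSpace 𝓘(ℝ, F) p) :
    g.inner (ι p) (mfderiv 𝓘(ℝ, F) 𝓘(ℝ, E) ι p (ξ p)) (dIsotropicVector g ι ξ p b) = 0 := by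
  rw [inner_dIsotropicVector hV.contMDiff hξ.contMDiffAt,
    ← localField_apply_chart ξ (mem_extChartAt_source p)]
  refine local_second_form_null ((contDiffAt_localRep hV.contMDiff p).of_le (by norm_cast)) ?_
    (differentiableAt_localField hξ.contMDiffAt) (g.inChart_symm (ι p))
    (eventually_localPush_orthogonal hV hξ) ?_ _
  · rw [localRep_center]
    exact g.differentiableAt_inChart (ι p)
  · rw [localRep_center]
    exact g.two_mul_inChart_christoffel (mem_extChartAt_target (ι p))

variable {k : ℕ} {e : Fin k → TangentSpace 𝓘(ℝ, F) p}

theorem screenMetric_posDef (hV : IsLightlikeHypersurface (F := F) g ι)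
    (hξ : IsIsotropicFieldAt g ι ξ p)
    (he : LinearIndependent ℝ (Fin.cons (ξ p) e : Fin (k + 1) → TangentSpace 𝓘(ℝ, F) p)) :
    (screenMetric (E := E) g ι p e).PosDef :=
  screen_posDef (β := g.bilin (ι p)) (i := (mfderiv 𝓘(ℝ, F) 𝓘(ℝ, E) ι p).toLinearMap)
    (g.sigPos_add_one (ι p)) (g.symm (ι p)) (hV.injective p)
    (hV.orthogonal_of_isotropic hξ.isotropic.self_of_nhds) he

theorem secondFundamentalTensor_isSymm (hV : IsLightlikeHypersurface (F := F) g ι)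
    (hξ : IsIsotropicFieldAt g ι ξ p) : (secondFundamentalTensor g ι ξ p e).IsSymm := by
  ext a b
  exact second_fundamental_form_symm hV hξ _ _

instance [FiniteDimensional ℝ F] (q : N) : FiniteDimensional ℝ (TangentSpace 𝓘(ℝ, F) q) :=
  inferInstanceAs (FiniteDimensional ℝ F)

variable [FiniteDimensional ℝ F]

theorem finrank_displacements_eq_rank (hV : IsLightlikeHypersurface (F := F) g ι)
    (hξ : IsIsotropicFieldAt g ι ξ p) (hk : finrank ℝ F = k + 1)
    (he : LinearIndependent ℝ (Fin.cons (ξ p) e : Fin (k + 1) → TangentSpace 𝓘(ℝ, F) p))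
    (r s : ℝ) :
    finrank ℝ (Submodule.span ℝ {w | ∃ (v : TangentSpace 𝓘(ℝ, F) p) (σ : ℝ),
      w = r • mfderiv 𝓘(ℝ, F) 𝓘(ℝ, E) ι p v + s • dIsotropicVector g ι ξ p v
        + σ • isotropicVector ι ξ p})
      = (r • (1 : Matrix (Fin k) (Fin k) ℝ) + s • shapeOperator g ι ξ p e).rank + 1 :=
  finrank_displacements (β := g.bilin (ι p))
    (i := (mfderiv 𝓘(ℝ, F) 𝓘(ℝ, E) ι p).toLinearMap)
    (D := dIsotropicVectorLinear g hV.contMDiff hξ.contMDiffAt)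
    (g.sigPos_add_one (ι p)) (g.sigNeg_eq_one (ι p)) (g.symm (ι p)) (hV.injective p)
    hV.codim_one (hV.orthogonal_of_isotropic hξ.isotropic.self_of_nhds) hk he
    (second_fundamental_form_symm hV hξ) (inner_isotropicVector_dIsotropicVector hV hξ) r s

theorem finrank_developedTangentSpace_coe (hV : IsLightlikeHypersurface (F := F) g ι)
    (hξ : IsIsotropicFieldAt g ι ξ p) (hk : finrank ℝ F = k + 1)
    (he : LinearIndependent ℝ (Fin.cons (ξ p) e : Fin (k + 1) → TangentSpace 𝓘(ℝ, F) p)) (s : ℝ) :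
    finrank ℝ (developedTangentSpace g ι ξ p s)
      = ((1 : ℝ) • (1 : Matrix (Fin k) (Fin k) ℝ) + s • shapeOperator g ι ξ p e).rank + 1 := by
  rw [← finrank_displacements_eq_rank hV hξ hk he]
  exact congrArg (fun S ↦ finrank ℝ (Submodule.span ℝ S))
    (setOf_one_smul_add (mfderiv 𝓘(ℝ, F) 𝓘(ℝ, E) ι p) (dIsotropicVector g ι ξ p)
      (isotropicVector ι ξ p) s).symm

theorem finrank_developedTangentSpace_infty (hV : IsLightlikeHypersurface (F := F) g ι)
    (hξ : IsIsotropicFieldAt g ι ξ p) (hk : finrank ℝ F = k + 1)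
    (he : LinearIndependent ℝ (Fin.cons (ξ p) e : Fin (k + 1) → TangentSpace 𝓘(ℝ, F) p)) :
    finrank ℝ (developedTangentSpace g ι ξ p OnePoint.infty)
      = ((0 : ℝ) • (1 : Matrix (Fin k) (Fin k) ℝ) + (1 : ℝ) • shapeOperator g ι ξ p e).rank
        + 1 := by
  rw [← finrank_displacements_eq_rank hV hξ hk he]
  exact congrArg (fun S ↦ finrank ℝ (Submodule.span ℝ S))
    (setOf_zero_smul_add (mfderiv 𝓘(ℝ, F) 𝓘(ℝ, E) ι p) (dIsotropicVector g ι ξ p)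
      (isotropicVector ι ξ p)).symm

end SecondFundamentalForm

end

/-! ### The singular points on an isotropic geodesic -/

theorem theorem3 {E : Type*} [NormedAddCommGroup E] [NormedSpace ℝ E] [FiniteDimensional ℝ E]
    {F : Type*} [NormedAddCommGroup F] [NormedSpace ℝ F] [FiniteDimensional ℝ F]
    {M : Type*} [TopologicalSpace M] [ChartedSpace E M] [IsManifold 𝓘(ℝ, E) ∞ M]
    {N : Type*} [TopologicalSpace N] [ChartedSpace F N] [IsManifold 𝓘(ℝ, F) ∞ N]
    (n : ℕ) (hn : finrank ℝ E = n)
    (g : LorentzianMetric E M) (ι : N → M) (hV : IsLightlikeHypersurface (F := F) g ι)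
    (c : ℝ → N) (J : Set ℝ) (hc : IsIsotropicGeodesic (F := F) g ι c J) (t : ℝ) (ht : t ∈ J)
    (ξ : (q : N) → TangentSpace 𝓘(ℝ, F) q) (hξ : IsIsotropicFieldAt g ι ξ (c t))
    (hξc : ξ (c t) = velocity c t)
    (e : Fin (n - 2) → TangentSpace 𝓘(ℝ, F) (c t))
    (he : LinearIndependent ℝ
      (Fin.cons (ξ (c t)) e : Fin (n - 2 + 1) → TangentSpace 𝓘(ℝ, F) (c t))) :
    (screenMetric (E := E) g ι (c t) e * shapeOperator g ι ξ (c t) e).IsSymm ∧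
    ∃ ev : Fin (n - 2) → ℝ,
      (shapeOperator g ι ξ (c t) e).charpoly = ∏ a, (X - C (ev a)) ∧
      {y | IsSingularPoint g ι ξ (c t) y} = Set.range (fun a ↦ focus (ev a)) ∧
      {y : TangentSpace 𝓘(ℝ, E) (ι (c t)) | ∃ s : ℝ, IsSingularPoint g ι ξ (c t) (s : OnePoint ℝ) ∧
          y = s • isotropicVector ι ξ (c t)} =
        {y | ∃ a, ev a ≠ 0 ∧ y = -(1 / ev a) • isotropicVector ι ξ (c t)} ∧
      (∀ y : OnePoint ℝ, singularMultiplicity (shapeOperator g ι ξ (c t) e) y =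
        {a | focus (ev a) = y}.ncard) ∧
      (∀ y : OnePoint ℝ, singularMultiplicity (shapeOperator g ι ξ (c t) e) y +
        finrank ℝ (developedTangentSpace g ι ξ (c t) y) = n - 1) ∧
      ∑ᶠ y ∈ {y | IsSingularPoint g ι ξ (c t) y},
        singularMultiplicity (shapeOperator g ι ξ (c t) e) y = n - 2 := by
  have hne : ξ (c t) ≠ 0 := he.ne_zero 0
  have hcodim := hV.codim_one
  -- A nonzero tangent vector forces $\dim V\ge1$, hence $n\ge2$, so the truncated subtraction `n -
  -- 2` is a true one.
  have hF : finrank ℝ F ≠ 0 := by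
    intro h0
    exact hne (finrank_zero_iff_forall_zero.1 h0 (ξ (c t)))
  have hk : finrank ℝ F = n - 2 + 1 := by omega
  have hdet : IsUnit (screenMetric (E := E) g ι (c t) e).det :=
    (Matrix.isUnit_iff_isUnit_det _).1 (screenMetric_posDef hV hξ he).isUnit
  have hS := secondFundamentalTensor_isSymm (e := e) hV hξ
  -- Lowering the index cancels the inverse metric and returns the symmetric tensor $\lambda_{ab}$.
  refine ⟨by rwa [shapeOperator, Matrix.mul_nonsing_inv_cancel_left _ _ hdet], ?_⟩
  obtain ⟨P, d, hd⟩ := (screenMetric_posDef hV hξ he).exists_diagonalization_inv_mul hS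
  have hdim := singularMultiplicity_add_dim
    (dim := fun y ↦ finrank ℝ (developedTangentSpace g ι ξ (c t) y)) hd
    (finrank_developedTangentSpace_infty hV hξ hk he)
    (finrank_developedTangentSpace_coe hV hξ hk he)
  have hsing : {y | IsSingularPoint g ι ξ (c t) y} = Set.range fun a ↦ focus (d a) := by
    rw [← setOf_dim_lt_eq_range_focus hd hdim, ← hk]
    rfl
  refine ⟨d, charpoly_of_diagonalization hd, hsing, ?_, singularMultiplicity_of_diagonalization hd,
    fun y ↦ (hdim y).trans (by omega), ?_⟩
  -- Only nonzero eigenvalues give foci at finite distance; a zero one would put the focus at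
  -- infinity.
  · have hs : ∀ s : ℝ, IsSingularPoint g ι ξ (c t) s ↔ ∃ a, focus (d a) = s :=
      fun s ↦ Set.ext_iff.1 hsing s
    ext y
    simp only [Set.mem_ofPred_eq, hs]
    constructor
    · rintro ⟨s, ⟨a, ha⟩, rfl⟩
      have h0 : d a ≠ 0 := fun h0 ↦ by simp [focus, h0] at ha
      rw [focus, if_neg h0, OnePoint.coe_eq_coe] at ha
      exact ⟨a, h0, by rw [ha]⟩
    · rintro ⟨a, h0, rfl⟩
      exact ⟨_, ⟨a, by rw [focus, if_neg h0]⟩, rfl⟩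
  · rw [hsing]
    exact finsum_singularMultiplicity hd
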